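/- Let $n\ge 3$, $\mathbb R^n_+=\{x\in\mathbb R^n: x_n>0\}$, $B_r^+=B_r(0)\cap\mathbb R^n_+$, and let $\mathbb S^2\subset\mathbb R^3$ be the unit sphere. For an open set $\Omega\subset\mathbb R^n$ let $W^{1,2}(\Omega,\mathbb S^2)$ be the set of $u\in W^{1,2}(\Omega,\mathbb R^3)$ with $|u|=1$ a.e. in $\Omega$; equality of boundary data, $v=u$ on $\partial\Omega$, is understood in the sense of traces, i.e. $v-u\in W^{1,2}_0(\Omega,\mathbb R^3)$. A map $u$ is a minimizing harmonic map in $\Omega$ if $u\in W^{1,2}(\Omega,\mathbb S^2)$ and $\int_\Omega|\nabla u|^2\,dx\le\int_\Omega|\nabla v|^2\,dx$ for all $v\in W^{1,2}(\Omega,\mathbb S^2)$ with $v=u$ on $\partial\Omega$. Assume that $u\in W^{1,2}(B_1^+\setminus \overline{B_\delta(0)},\mathbb S^2)$ for every $\delta>0$, that $$\sup_{\delta\in(0,1)}\int_{B_1^+\setminus B_\delta(0)}|\nabla u|^2\,dx<\infty,$$ and that $u$ is a minimizer away from the origin: for every $\delta\in(0,1)$ and every $v\in W^{1,2}(B_1^+,\mathbb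 S^2)$ with $v=u$ on $\partial B_1^+$ and $v=u$ on $\partial B_\delta^+$, $$\int_{B_1^+\setminus B_\delta(0)}|\nabla u|^2\,dx\le\int_{B_1^+\setminus B_\delta(0)}|\nabla v|^2\,dx.$$ Then $u\in W^{1,2}(B_1^+)$, and $u$ is a minimizing harmonic map in all of $B_1^+$. -/

import Mathlib

open MeasureTheory Set
open scoped ENNReal ContDiff

/-- `ℝⁿ` with its Euclidean norm and Lebesgue measure. -/
abbrev Rn (n : ℕ) : Type := EuclideanSpace ℝ (Fin n)

/-- The open upper half-space `{x ∈ ℝⁿ : x_n > 0}`: positivity of the last coordinate. -/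
def upperHalfSpace (n : ℕ) : Set (Rn n) :=
  {x | ∀ i : Fin n, (i : ℕ) + 1 = n → 0 < x i}

/-- The open half-ball `B_r⁺ = B_r(0) ∩ {x_n > 0}`. -/
def halfBall (n : ℕ) (r : ℝ) : Set (Rn n) :=
  Metric.ball 0 r ∩ upperHalfSpace n

/-- The half-annulus `B_1⁺ ∖ B_δ`, taken as an open set. -/
def halfAnnulus (n : ℕ) (δ : ℝ) : Set (Rn n) :=
  halfBall n 1 \ Metric.closedBall 0 δ

/-- The classical partial derivative `∂_i φ`. -/
noncomputable def partialDeriv {n : ℕ} {F : Type*} [NormedAddCommGroup F] [NormedSpace ℝ F]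
    (i : Fin n) (φ : Rn n → F) (x : Rn n) : F :=
  fderiv ℝ φ x (EuclideanSpace.single i 1)

/-- `φ ∈ C_c^∞(Ω, F)`. -/
def IsTestFunction {n : ℕ} {F : Type*} [NormedAddCommGroup F] [NormedSpace ℝ F]
    (Ω : Set (Rn n)) (φ : Rn n → F) : Prop :=
  ContDiff ℝ ∞ φ ∧ HasCompactSupport φ ∧ tsupport φ ⊆ Ω

/-- `g = (g_1, …, g_n)` is the weak gradient of the `ℝ³`-valued map `u` on the open set `Ω`:
`∫_Ω ∂_i φ u = - ∫_Ω φ g_i` for every scalar test function `φ` and every `i`. -/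
def HasWeakGradient {n : ℕ} (Ω : Set (Rn n)) (u : Rn n → Rn 3) (g : Fin n → Rn n → Rn 3) :
    Prop :=
  LocallyIntegrableOn u Ω volume ∧
  (∀ i, LocallyIntegrableOn (g i) Ω volume) ∧
  ∀ φ : Rn n → ℝ, IsTestFunction Ω φ → ∀ i,
    ∫ x in Ω, partialDeriv i φ x • u x = - ∫ x in Ω, φ x • g i x

/-- `u ∈ L²(Ω, ℝ³)` has the weak gradient `g`, with all components in `L²(Ω, ℝ³)`. -/
def HasL2WeakGradient {n : ℕ} (Ω : Set (Rn n)) (u : Rn n → Rn 3) (g : Fin n → Rn n → Rn 3) :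
    Prop :=
  MemLp u 2 (volume.restrict Ω) ∧ (∀ i, MemLp (g i) 2 (volume.restrict Ω)) ∧
  HasWeakGradient Ω u g

/-- `u ∈ W^{1,2}(Ω, ℝ³)`. -/
def MemW12 {n : ℕ} (Ω : Set (Rn n)) (u : Rn n → Rn 3) : Prop :=
  ∃ g, HasL2WeakGradient Ω u g

/-- `u ∈ W^{1,2}(Ω, 𝕊²)`. -/
def MemW12Sphere {n : ℕ} (Ω : Set (Rn n)) (u : Rn n → Rn 3) : Prop :=
  MemW12 Ω u ∧ ∀ᵐ x ∂(volume.restrict Ω), u x ∈ Metric.sphere (0 : Rn 3) 1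

/-- `u ∈ W_0^{1,2}(Ω, ℝ³)`, the closure of `C_c^∞(Ω, ℝ³)` in `W^{1,2}(Ω, ℝ³)`. -/
def MemW012 {n : ℕ} (Ω : Set (Rn n)) (u : Rn n → Rn 3) : Prop :=
  ∃ g, HasL2WeakGradient Ω u g ∧
    ∀ ε : ℝ≥0∞, 0 < ε → ∃ φ : Rn n → Rn 3, IsTestFunction Ω φ ∧
      eLpNorm (u - φ) 2 (volume.restrict Ω) < ε ∧
      ∀ i, eLpNorm (g i - partialDeriv i φ) 2 (volume.restrict Ω) < ε

/-- `u = v` on `∂Ω` in the sense of traces of `W^{1,2}`-maps: `u - v ∈ W_0^{1,2}(Ω, ℝ³)`. -/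
def SameTrace {n : ℕ} (Ω : Set (Rn n)) (u v : Rn n → Rn 3) : Prop :=
  MemW012 Ω (u - v)

/-- The Dirichlet energy `∫_Ω |∇u|²`, where `|∇u|² = ∑_i |∂_i u|²`. The weak gradient is unique
almost everywhere, so the infimum is over a single value; it is `∞` if there is no weak
gradient. -/
noncomputable def dirichletEnergy {n : ℕ} (Ω : Set (Rn n)) (u : Rn n → Rn 3) : ℝ≥0∞ :=
  ⨅ (g : Fin n → Rn n → Rn 3) (_ : HasWeakGradient Ω u g), ∫⁻ x in Ω, ∑ i, ‖g i x‖ₑ ^ 2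

/-- `u` is a minimizing harmonic map from `Ω` to `𝕊²`: it lies in `W^{1,2}(Ω, 𝕊²)` and minimizes
the Dirichlet energy among the maps of `W^{1,2}(Ω, 𝕊²)` with the same boundary data. -/
def IsMinimizingHarmonicMap {n : ℕ} (Ω : Set (Rn n)) (u : Rn n → Rn 3) : Prop :=
  MemW12Sphere Ω u ∧
  ∀ v : Rn n → Rn 3, MemW12Sphere Ω v → SameTrace Ω v u →
    dirichletEnergy Ω u ≤ dirichletEnergy Ω v

/-!
Let `v` be a competitor for `u` on the half-ball `B_1⁺`, with the same trace. The hypothesis only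
compares `u` with maps that agree with `u` near the origin, so `v` is modified there: with a cutoff
`η` that vanishes on `B_δ` and equals `1` off `B_{2δ}`, the map `q = u + η (v - u)` agrees with `u`
on `B_δ` and with `v` off `B_{2δ}`, but is not sphere-valued in between. It is projected back to
the sphere along the rays from an interior point `a`, `‖a‖ ≤ 1/2` (`raySphere`). This map fixes
`𝕊²` and its derivative at `y` is at most `C / ‖y - a‖`. Since `‖z‖⁻²` is locally integrable in
`ℝ³`, averaging over `a` shows that some `a` raises the energy on `B_{2δ}` at most by a constant
factor (`exists_raySphere_comp_energy_le`). The resulting map `w` satisfies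
`∫ |∇w|² ≤ ∫ |∇v|² + C ∫_{B_{2δ}} (|∇u|² + |∇v|² + δ⁻² + 1)` (`exists_interpolation`), and for
`n ≥ 3` the last integral tends to `0` with `δ` (`tendsto_interpolation_error`). Hence
`∫_{B_1⁺ ∖ B_δ} |∇u|² ≤ ∫ |∇w|²` gives the minimality of `u` in the limit.

The map `w` must have the trace of `u`. The projection is Lipschitz at the points of the sphere,
so `‖w - u‖ ≤ L ‖v - u‖`, and a map of `W^{1,2}` dominated by a map of `W_0^{1,2}` lies in
`W_0^{1,2}` (`MemW012.of_norm_le`). For the latter, smooth approximations are truncated at the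
height of the dominating test functions. The truncations are test functions that are bounded in
`W^{1,2}` and converge in `L²`, which suffices because a closed subspace of a Hilbert space is
weakly closed (`memW012_of_bounded_of_tendsto`).

The origin is not a point of `B_1⁺`, so the half-annuli exhaust `B_1⁺`. The gradients of `u` on
them glue to a weak gradient on `B_1⁺`, which is square-integrable by the uniform energy bound
(`exists_hasL2WeakGradient_iUnion`).
-/

/-! ### Weak gradients -/

section WeakGradient

variable {n : ℕ} {Ω Ω' : Set (Rn n)} {u v : Rn n → Rn 3} {g h : Fin n → Rn n → Rn 3}

theorem IsTestFunction.mono {F : Type*} [NormedAddCommGroup F] [NormedSpace ℝ F]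
    {φ : Rn n → F} (hφ : IsTestFunction Ω' φ) (hΩ : Ω' ⊆ Ω) : IsTestFunction Ω φ :=
  ⟨hφ.1, hφ.2.1, hφ.2.2.trans hΩ⟩

theorem continuous_partialDeriv {F : Type*} [NormedAddCommGroup F] [NormedSpace ℝ F]
    {φ : Rn n → F} (hφ : ContDiff ℝ ∞ φ) (i : Fin n) : Continuous (partialDeriv i φ) :=
  (hφ.continuous_fderiv (by simp)).clm_apply continuous_const

theorem partialDeriv_eq_zero_of_notMem_tsupport {F : Type*} [NormedAddCommGroup F]
    [NormedSpace ℝ F] {φ : Rn n → F} {x : Rn n} (hx : x ∉ tsupport φ) (i : Fin n) :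
    partialDeriv i φ x = 0 := by
  have : fderiv ℝ φ x = 0 := by
    by_contra h
    exact hx (support_fderiv_subset ℝ h)
  simp [partialDeriv, this]

theorem hasCompactSupport_partialDeriv {F : Type*} [NormedAddCommGroup F] [NormedSpace ℝ F]
    {φ : Rn n → F} (hφ : HasCompactSupport φ) (i : Fin n) :
    HasCompactSupport (partialDeriv i φ) :=
  hφ.mono' fun x hx => by
    by_contra h
    exact hx (partialDeriv_eq_zero_of_notMem_tsupport h i)

theorem norm_partialDeriv_le {F : Type*} [NormedAddCommGroup F] [NormedSpace ℝ F]
    (φ : Rn n → F) (i : Fin n) (x : Rn n) : ‖partialDeriv i φ x‖ ≤ ‖fderiv ℝ φ x‖ := by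
  simpa [partialDeriv] using (fderiv ℝ φ x).le_opNorm (EuclideanSpace.single i 1)

theorem partialDeriv_mul {φ η : Rn n → ℝ} {x : Rn n} (hφ : DifferentiableAt ℝ φ x)
    (hη : DifferentiableAt ℝ η x) (i : Fin n) :
    partialDeriv i (fun x => φ x * η x) x = φ x * partialDeriv i η x + η x * partialDeriv i φ x := by
  simp [partialDeriv, fderiv_fun_mul hφ hη]

theorem MeasureTheory.MemLp.locallyIntegrableOn_of_restrict {F : Type*} [NormedAddCommGroup F]
    {f : Rn n → F} (hf : MemLp f 2 (volume.restrict Ω)) : LocallyIntegrableOn f Ω volume := by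
  intro x _
  refine ⟨Metric.ball x 1 ∩ Ω, Filter.inter_mem
    (mem_nhdsWithin_of_mem_nhds (Metric.ball_mem_nhds x one_pos)) self_mem_nhdsWithin, ?_⟩
  have : IsFiniteMeasure (volume.restrict (Metric.ball x 1 ∩ Ω)) :=
    isFiniteMeasure_restrict.2
      ((measure_mono inter_subset_left).trans_lt Metric.isBounded_ball.measure_lt_top).ne
  exact (hf.mono_measure (Measure.restrict_mono_set _ inter_subset_right)).integrable
    (by norm_num)

/-- The product of a continuous function supported in a compact subset of `Ω` with a function
that is locally integrable on `Ω` is integrable. -/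
theorem MeasureTheory.LocallyIntegrableOn.integrable_smul_of_tsupport {F : Type*}
    [NormedAddCommGroup F] [NormedSpace ℝ F]
    {f : Rn n → F} (hf : LocallyIntegrableOn f Ω volume) {φ : Rn n → ℝ} (hφ : Continuous φ)
    {K : Set (Rn n)} (hK : IsCompact K) (hKΩ : K ⊆ Ω) (h0 : ∀ x, x ∉ K → φ x = 0) :
    Integrable (fun x => φ x • f x) volume := by
  have h1 : IntegrableOn f K := hf.integrableOn_compact_subset hKΩ hK
  have h2 : IntegrableOn (fun x => φ x • f x) K := h1.continuousOn_smul hφ.continuousOn hK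
  exact h2.integrable_of_forall_notMem_eq_zero fun x hx => by simp [h0 x hx]

theorem setIntegral_smul_of_tsupport {F : Type*}
    [NormedAddCommGroup F] [NormedSpace ℝ F] (f : Rn n → F) {φ : Rn n → ℝ}
    {K : Set (Rn n)} (hKΩ : K ⊆ Ω) (h0 : ∀ x, x ∉ K → φ x = 0) :
    ∫ x in Ω, φ x • f x = ∫ x, φ x • f x :=
  setIntegral_eq_integral_of_forall_compl_eq_zero fun x hx => by
    simp [h0 x fun h => hx (hKΩ h)]

theorem IsTestFunction.eq_zero {φ : Rn n → ℝ} : ∀ x, x ∉ tsupport φ → φ x = 0 :=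
  fun _ hx => image_eq_zero_of_notMem_tsupport hx

/-- The integrals that define a weak gradient may be taken over the whole space. -/
theorem HasWeakGradient.integral_eq (hu : HasWeakGradient Ω u g) {φ : Rn n → ℝ}
    (hφ : IsTestFunction Ω φ) (i : Fin n) :
    ∫ x, partialDeriv i φ x • u x = - ∫ x, φ x • g i x := by
  have := hu.2.2 φ hφ i
  rwa [setIntegral_smul_of_tsupport _ hφ.2.2
      fun x hx => partialDeriv_eq_zero_of_notMem_tsupport hx i,
    setIntegral_smul_of_tsupport _ hφ.2.2 IsTestFunction.eq_zero] at this

theorem hasWeakGradient_iff : HasWeakGradient Ω u g ↔ LocallyIntegrableOn u Ω volume ∧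
    (∀ i, LocallyIntegrableOn (g i) Ω volume) ∧ ∀ φ : Rn n → ℝ, IsTestFunction Ω φ → ∀ i,
      ∫ x, partialDeriv i φ x • u x = - ∫ x, φ x • g i x := by
  refine ⟨fun h => ⟨h.1, h.2.1, fun φ hφ i => h.integral_eq hφ i⟩,
    fun h => ⟨h.1, h.2.1, fun φ hφ i => ?_⟩⟩
  rw [setIntegral_smul_of_tsupport _ hφ.2.2
      fun x hx => partialDeriv_eq_zero_of_notMem_tsupport hx i,
    setIntegral_smul_of_tsupport _ hφ.2.2 IsTestFunction.eq_zero]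
  exact h.2.2 φ hφ i

theorem HasWeakGradient.mono (hu : HasWeakGradient Ω u g) (hΩ : Ω' ⊆ Ω) :
    HasWeakGradient Ω' u g :=
  hasWeakGradient_iff.2 ⟨hu.1.mono_set hΩ, fun i => (hu.2.1 i).mono_set hΩ,
    fun _ hφ i => hu.integral_eq (hφ.mono hΩ) i⟩

theorem HasL2WeakGradient.mono (hu : HasL2WeakGradient Ω u g) (hΩ : Ω' ⊆ Ω) :
    HasL2WeakGradient Ω' u g :=
  ⟨hu.1.mono_measure (Measure.restrict_mono_set _ hΩ),
    fun i => (hu.2.1 i).mono_measure (Measure.restrict_mono_set _ hΩ), hu.2.2.mono hΩ⟩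

theorem HasWeakGradient.add (hu : HasWeakGradient Ω u g) (hv : HasWeakGradient Ω v h) :
    HasWeakGradient Ω (u + v) (fun i => g i + h i) := by
  refine hasWeakGradient_iff.2 ⟨hu.1.add hv.1, fun i => (hu.2.1 i).add (hv.2.1 i),
    fun φ hφ i => ?_⟩
  have hφi := continuous_partialDeriv hφ.1 i
  have h0 : ∀ x, x ∉ tsupport φ → partialDeriv i φ x = 0 :=
    fun x hx => partialDeriv_eq_zero_of_notMem_tsupport hx i
  simp only [Pi.add_apply, smul_add]
  rw [integral_add (hu.1.integrable_smul_of_tsupport hφi hφ.2.1 hφ.2.2 h0)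
      (hv.1.integrable_smul_of_tsupport hφi hφ.2.1 hφ.2.2 h0),
    integral_add ((hu.2.1 i).integrable_smul_of_tsupport hφ.1.continuous hφ.2.1 hφ.2.2
        IsTestFunction.eq_zero)
      ((hv.2.1 i).integrable_smul_of_tsupport hφ.1.continuous hφ.2.1 hφ.2.2
        IsTestFunction.eq_zero),
    hu.integral_eq hφ i, hv.integral_eq hφ i, neg_add]

theorem HasWeakGradient.neg (hu : HasWeakGradient Ω u g) :
    HasWeakGradient Ω (-u) (fun i => -g i) := by
  refine hasWeakGradient_iff.2 ⟨hu.1.neg, fun i => (hu.2.1 i).neg, fun φ hφ i => ?_⟩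
  simp [integral_neg, hu.integral_eq hφ i]

theorem HasWeakGradient.sub (hu : HasWeakGradient Ω u g) (hv : HasWeakGradient Ω v h) :
    HasWeakGradient Ω (u - v) (fun i => g i - h i) := by
  simpa [sub_eq_add_neg] using hu.add hv.neg

theorem HasL2WeakGradient.add (hu : HasL2WeakGradient Ω u g) (hv : HasL2WeakGradient Ω v h) :
    HasL2WeakGradient Ω (u + v) (fun i => g i + h i) :=
  ⟨hu.1.add hv.1, fun i => (hu.2.1 i).add (hv.2.1 i), hu.2.2.add hv.2.2⟩

theorem HasL2WeakGradient.sub (hu : HasL2WeakGradient Ω u g) (hv : HasL2WeakGradient Ω v h) :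
    HasL2WeakGradient Ω (u - v) (fun i => g i - h i) :=
  ⟨hu.1.sub hv.1, fun i => (hu.2.1 i).sub (hv.2.1 i), hu.2.2.sub hv.2.2⟩

/-- Product rule for a smooth scalar factor. -/
theorem HasWeakGradient.smul (hu : HasWeakGradient Ω u g) {η : Rn n → ℝ} (hη : ContDiff ℝ ∞ η)
    (hΩ : IsOpen Ω) :
    HasWeakGradient Ω (fun x => η x • u x)
      (fun i x => partialDeriv i η x • u x + η x • g i x) := by
  have hηi := continuous_partialDeriv hη
  have hl {f : Rn n → Rn 3} {ζ : Rn n → ℝ} (hf : LocallyIntegrableOn f Ω volume)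
      (hζ : Continuous ζ) : LocallyIntegrableOn (fun x => ζ x • f x) Ω volume :=
    hf.continuousOn_smul hΩ.isLocallyClosed hζ.continuousOn
  refine hasWeakGradient_iff.2 ⟨hl hu.1 hη.continuous,
    fun i => (hl hu.1 (hηi i)).add (hl (hu.2.1 i) hη.continuous), fun φ hφ i => ?_⟩
  have hφη : IsTestFunction Ω (fun x => φ x * η x) :=
    ⟨hφ.1.mul hη, hφ.2.1.mul_right, (tsupport_mul_subset_left).trans hφ.2.2⟩
  have key := hu.integral_eq hφη i
  have hφi := continuous_partialDeriv hφ.1 i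
  have h0 : ∀ x, x ∉ tsupport φ → partialDeriv i φ x = 0 :=
    fun x hx => partialDeriv_eq_zero_of_notMem_tsupport hx i
  have e1 : (fun x => partialDeriv i (fun x => φ x * η x) x • u x) =
      fun x => φ x • partialDeriv i η x • u x + partialDeriv i φ x • η x • u x := by
    funext x
    rw [partialDeriv_mul (hφ.1.differentiable (by simp) x) (hη.differentiable (by simp) x),
      add_smul, mul_smul, mul_comm, mul_smul]
  have i1 := (hl hu.1 (hηi i)).integrable_smul_of_tsupport hφ.1.continuous hφ.2.1 hφ.2.2
    IsTestFunction.eq_zero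
  have i2 := (hl hu.1 hη.continuous).integrable_smul_of_tsupport hφi hφ.2.1 hφ.2.2 h0
  have i3 := (hl (hu.2.1 i) hη.continuous).integrable_smul_of_tsupport hφ.1.continuous hφ.2.1
    hφ.2.2 IsTestFunction.eq_zero
  rw [e1, integral_add i1 i2] at key
  simp only [mul_smul] at key
  simp only [smul_add]
  rw [integral_add i1 i3, neg_add, ← key]
  abel

/-- Product rule in `W^{1,2}`, for a smooth factor that is bounded together with its gradient. -/
theorem HasL2WeakGradient.smul (hu : HasL2WeakGradient Ω u g) {η : Rn n → ℝ}
    (hη : ContDiff ℝ ∞ η) (hΩ : IsOpen Ω) {C C' : ℝ} (h0 : ∀ x, ‖η x‖ ≤ C)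
    (h1 : ∀ x, ‖fderiv ℝ η x‖ ≤ C') :
    HasL2WeakGradient Ω (fun x => η x • u x)
      (fun i x => partialDeriv i η x • u x + η x • g i x) := by
  have hm {f : Rn n → Rn 3} {ζ : Rn n → ℝ} {c : ℝ} (hf : MemLp f 2 (volume.restrict Ω))
      (hζ : Continuous ζ) (hc : ∀ x, ‖ζ x‖ ≤ c) :
      MemLp (fun x => ζ x • f x) 2 (volume.restrict Ω) :=
    hf.of_le_mul (c := c) (hζ.aestronglyMeasurable.smul hf.1) (.of_forall fun x => by
      rw [norm_smul]; gcongr; exact hc x)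
  exact ⟨hm hu.1 hη.continuous h0, fun i => (hm hu.1 (continuous_partialDeriv hη i)
    fun x => (norm_partialDeriv_le η i x).trans (h1 x)).add (hm (hu.2.1 i) hη.continuous h0),
    hu.2.2.smul hη hΩ⟩

theorem HasWeakGradient.congr (hu : HasWeakGradient Ω u g)
    (huv : u =ᵐ[volume.restrict Ω] v)
    (hgh : ∀ i, g i =ᵐ[volume.restrict Ω] h i) : HasWeakGradient Ω v h := by
  refine ⟨hu.1.congr huv, fun i => (hu.2.1 i).congr (hgh i), fun φ hφ i => ?_⟩
  have e1 : ∫ x in Ω, partialDeriv i φ x • u x = ∫ x in Ω, partialDeriv i φ x • v x :=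
    integral_congr_ae (huv.mono fun x hx => by simp only [hx])
  have e2 : ∫ x in Ω, φ x • g i x = ∫ x in Ω, φ x • h i x :=
    integral_congr_ae ((hgh i).mono fun x hx => by simp only [hx])
  rw [← e1, ← e2]
  exact hu.2.2 φ hφ i

/-- The weak gradient is unique up to null sets. -/
theorem HasWeakGradient.ae_eq (hΩ : IsOpen Ω) (hu : HasWeakGradient Ω u g)
    (hu' : HasWeakGradient Ω u h) (i : Fin n) : g i =ᵐ[volume.restrict Ω] h i := by
  have := hΩ.ae_eq_zero_of_integral_contDiff_smul_eq_zero ((hu.2.1 i).sub (hu'.2.1 i))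
    fun φ h1 h2 h3 => by
      have hφ : IsTestFunction Ω φ := ⟨h1, h2, h3⟩
      simp only [Pi.sub_apply, smul_sub]
      rw [integral_sub ((hu.2.1 i).integrable_smul_of_tsupport hφ.1.continuous hφ.2.1 hφ.2.2
        IsTestFunction.eq_zero)
        ((hu'.2.1 i).integrable_smul_of_tsupport hφ.1.continuous hφ.2.1 hφ.2.2
        IsTestFunction.eq_zero), ← neg_inj, neg_sub, sub_eq_neg_add, ← hu.integral_eq hφ i,
        ← neg_neg (∫ x, φ x • h i x), ← hu'.integral_eq hφ i]
      simp
  rw [Filter.EventuallyEq, ae_restrict_iff' hΩ.measurableSet]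
  filter_upwards [this] with x hx hxΩ
  exact sub_eq_zero.1 (hx hxΩ)

theorem dirichletEnergy_eq (hΩ : IsOpen Ω) (hu : HasWeakGradient Ω u g) :
    dirichletEnergy Ω u = ∫⁻ x in Ω, ∑ i, ‖g i x‖ₑ ^ 2 := by
  refine le_antisymm (iInf₂_le g hu) (le_iInf₂ fun h hh => le_of_eq (lintegral_congr_ae ?_))
  filter_upwards [ae_all_iff.2 fun i => hu.ae_eq hΩ hh i] with x hx
  exact Finset.sum_congr rfl fun i _ => by rw [hx i]

theorem isOpen_upperHalfSpace : IsOpen (upperHalfSpace n) := by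
  have : upperHalfSpace n = ⋂ i : Fin n, {x | (i : ℕ) + 1 = n → 0 < x i} := by
    ext; simp [upperHalfSpace]
  rw [this]
  refine isOpen_iInter_of_finite fun i => ?_
  by_cases h : (i : ℕ) + 1 = n
  · simpa [h] using isOpen_lt continuous_const (by fun_prop : Continuous fun x : Rn n => x i)
  · simp [h]

theorem isOpen_halfBall (r : ℝ) : IsOpen (halfBall n r) :=
  Metric.isOpen_ball.inter isOpen_upperHalfSpace

theorem isOpen_halfAnnulus (δ : ℝ) : IsOpen (halfAnnulus n δ) :=
  (isOpen_halfBall 1).sdiff Metric.isClosed_closedBall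

end WeakGradient

/-! ### Mollification -/

section Mollification

open Filter Topology
open scoped Convolution

variable {n : ℕ}

theorem eLpNorm_two_sq {α F : Type*} [MeasurableSpace α] [NormedAddCommGroup F] (f : α → F)
    (μ : Measure α) : eLpNorm f 2 μ ^ 2 = ∫⁻ x, ‖f x‖ₑ ^ 2 ∂μ := by
  simpa using eLpNorm_nnreal_pow_eq_lintegral (f := f) (μ := μ) (p := 2) (by norm_num)

/-- Jensen's inequality for the square of an average with weight `ρ`. -/
theorem enorm_integral_smul_sq_le {ρ : Rn n → ℝ} (hc : Continuous ρ) (h0 : ∀ x, 0 ≤ ρ x)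
    (h1 : ∫ x, ρ x = 1) {f : Rn n → Rn 3} (hf : AEStronglyMeasurable f volume) :
    ‖∫ t, ρ t • f t‖ₑ ^ 2 ≤ ∫⁻ t, ENNReal.ofReal (ρ t) * ‖f t‖ₑ ^ 2 := by
  have hρm : Measurable fun t => ENNReal.ofReal (ρ t) := hc.measurable.ennreal_ofReal
  set P : Measure (Rn n) := volume.withDensity fun t => ENNReal.ofReal (ρ t) with hP
  have hint : Integrable ρ := by
    by_contra h
    rw [integral_undef h] at h1
    exact zero_ne_one h1
  have : IsProbabilityMeasure P := ⟨by
    rw [hP, withDensity_apply _ MeasurableSet.univ, Measure.restrict_univ,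
      ← ofReal_integral_eq_lintegral_ofReal hint (.of_forall h0), h1, ENNReal.ofReal_one]⟩
  have hd (k : Rn n → ℝ≥0∞) : ∫⁻ t, k t ∂P = ∫⁻ t, ENNReal.ofReal (ρ t) * k t :=
    lintegral_withDensity_eq_lintegral_mul_non_measurable _ hρm (.of_forall fun _ => by simp) _
  have hfP : AEStronglyMeasurable f P := hf.mono_ac (withDensity_absolutelyContinuous _ _)
  calc ‖∫ t, ρ t • f t‖ₑ ^ 2 ≤ (eLpNorm f 1 P) ^ 2 := by
        gcongr
        rw [eLpNorm_one_eq_lintegral_enorm, hd]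
        refine (enorm_integral_le_lintegral_enorm _).trans_eq (lintegral_congr fun t => ?_)
        rw [enorm_smul, Real.enorm_of_nonneg (h0 t)]
    _ ≤ (eLpNorm f 2 P) ^ 2 := by
        gcongr
        exact eLpNorm_le_eLpNorm_of_exponent_le (by norm_num) hfP
    _ = _ := by rw [eLpNorm_two_sq, hd]

theorem convolutionExists_of_memLp {ρ : Rn n → ℝ} (hc : Continuous ρ) (hs : HasCompactSupport ρ)
    {f : Rn n → Rn 3} (hf : MemLp f 2 volume) :
    ConvolutionExists ρ f (ContinuousLinearMap.lsmul ℝ ℝ) volume :=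
  hs.convolutionExists_left _ hc (hf.locallyIntegrable (by norm_num))

/-- The distance from `f` to its mollification is controlled by the translates of `f`. -/
theorem eLpNorm_convolution_sub_le {ρ : Rn n → ℝ} (hc : Continuous ρ) (hs : HasCompactSupport ρ)
    (h0 : ∀ x, 0 ≤ ρ x) (h1 : ∫ x, ρ x = 1) {f : Rn n → Rn 3} (hf : MemLp f 2 volume) {ε : ℝ≥0∞}
    (hε : ∀ t, ρ t ≠ 0 → eLpNorm (fun x => f (x - t) - f x) 2 volume ≤ ε) :
    eLpNorm ((ρ ⋆[ContinuousLinearMap.lsmul ℝ ℝ, volume] f) - f) 2 volume ≤ ε := by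
  rw [← ENNReal.pow_le_pow_left_iff two_ne_zero, eLpNorm_two_sq]
  have hint : Integrable ρ := hc.integrable_of_hasCompactSupport hs
  have hm : AEStronglyMeasurable (fun p : Rn n × Rn n => f (p.1 - p.2) - f p.1)
      (volume.prod volume) :=
    (hf.1.comp_quasiMeasurePreserving
      (quasiMeasurePreserving_sub_of_right_invariant volume volume)).sub hf.1.comp_fst
  calc ∫⁻ x, ‖((ρ ⋆[ContinuousLinearMap.lsmul ℝ ℝ, volume] f) - f) x‖ₑ ^ 2
      ≤ ∫⁻ x, ∫⁻ t, ENNReal.ofReal (ρ t) * ‖f (x - t) - f x‖ₑ ^ 2 := by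
        refine lintegral_mono fun x => ?_
        have e : ((ρ ⋆[ContinuousLinearMap.lsmul ℝ ℝ, volume] f) - f) x =
            ∫ t, ρ t • (f (x - t) - f x) := by
          have : f x = ∫ t, ρ t • f x := by rw [integral_smul_const, h1, one_smul]
          simp only [smul_sub]
          rw [integral_sub _ (hint.smul_const _), ← this]
          · rfl
          · exact convolutionExists_of_memLp hc hs hf x
        rw [e]
        refine enorm_integral_smul_sq_le hc h0 h1 ?_
        exact (hf.1.comp_quasiMeasurePreserving
          (quasiMeasurePreserving_sub_left_of_right_invariant volume x)).sub
          aestronglyMeasurable_const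
    _ = ∫⁻ t, ∫⁻ x, ENNReal.ofReal (ρ t) * ‖f (x - t) - f x‖ₑ ^ 2 := by
        refine lintegral_lintegral_swap ?_
        exact (hc.comp continuous_snd).measurable.ennreal_ofReal.aemeasurable.mul
          (hm.enorm.pow_const 2)
    _ ≤ ∫⁻ t, ENNReal.ofReal (ρ t) * ε ^ 2 := by
        refine lintegral_mono fun t => ?_
        rw [lintegral_const_mul' _ _ ENNReal.ofReal_ne_top, ← eLpNorm_two_sq]
        by_cases ht : ρ t = 0
        · simp [ht]
        · gcongr
          exact hε t ht
    _ = ε ^ 2 := by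
        rw [lintegral_mul_const _ hc.measurable.ennreal_ofReal,
          ← ofReal_integral_eq_lintegral_ofReal hint (.of_forall h0), h1]
        simp

/-- Translations are continuous in `L²`. -/
theorem tendsto_eLpNorm_translate_sub {f : Rn n → Rn 3} (hf : MemLp f 2 volume) :
    Tendsto (fun t : Rn n => eLpNorm (fun x => f (x - t) - f x) 2 volume) (𝓝 0) (𝓝 0) := by
  let c : Rn n → C(Rn n, Rn n) := fun t => ⟨fun x => x - t, by fun_prop⟩
  have hc : Continuous c := ContinuousMap.continuous_of_continuous_uncurry _
    (show Continuous fun p : Rn n × Rn n => p.2 - p.1 by fun_prop)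
  have hp (t : Rn n) : MeasurePreserving (c t) volume volume := measurePreserving_sub_right _ t
  have h := (tendsto_const_nhds (x := hf.toLp f)).compMeasurePreservingLp (hc.tendsto 0) hp (hp 0)
    (by norm_num)
  have e (t : Rn n) : Lp.compMeasurePreserving (c t) (hp t) (hf.toLp f) =
      (hf.comp_measurePreserving (hp t)).toLp (f ∘ c t) :=
    Lp.toLp_compMeasurePreserving hf (hp t)
  simp only [e] at h
  rw [Lp.tendsto_Lp_iff_tendsto_eLpNorm''] at h
  refine h.congr fun t => ?_
  congr 1
  funext x
  simp [c]

/-- A fixed sequence of bump functions at the origin whose supports shrink to a point. -/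
noncomputable def mollifierBump (n j : ℕ) : ContDiffBump (0 : Rn n) :=
  ⟨1 / (j + 2), 1 / (j + 1), by positivity, by gcongr; linarith⟩

/-- The mollifications of `f` along `mollifierBump`. -/
noncomputable def mollify (j : ℕ) (f : Rn n → Rn 3) : Rn n → Rn 3 :=
  ((mollifierBump n j).normed volume) ⋆[ContinuousLinearMap.lsmul ℝ ℝ, volume] f

theorem contDiff_mollify (j : ℕ) {f : Rn n → Rn 3} (hf : MemLp f 2 volume) :
    ContDiff ℝ ∞ (mollify j f) :=
  (mollifierBump n j).hasCompactSupport_normed.contDiff_convolution_left _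
    (mollifierBump n j).contDiff_normed (hf.locallyIntegrable (by norm_num))

theorem tendsto_eLpNorm_mollify_sub {f : Rn n → Rn 3} (hf : MemLp f 2 volume) :
    Tendsto (fun j => eLpNorm (mollify j f - f) 2 volume) atTop (𝓝 0) := by
  rw [ENNReal.tendsto_nhds_zero]
  intro ε hε
  obtain ⟨r, hr, h⟩ := Metric.eventually_nhds_iff.1
    (ENNReal.tendsto_nhds_zero.1 (tendsto_eLpNorm_translate_sub hf) ε hε)
  filter_upwards [(tendsto_one_div_add_atTop_nhds_zero_nat (𝕜 := ℝ)).eventually_lt_const hr]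
    with j hj
  refine eLpNorm_convolution_sub_le (mollifierBump n j).continuous_normed
    (mollifierBump n j).hasCompactSupport_normed (mollifierBump n j).nonneg_normed
    (mollifierBump n j).integral_normed hf fun t ht => h ?_
  have : t ∈ Metric.ball (0 : Rn n) (mollifierBump n j).rOut := by
    rw [← (mollifierBump n j).support_normed_eq (μ := volume)]
    exact ht
  exact (Metric.mem_ball.1 this).trans hj

/-- Mollification commutes with weak differentiation on the whole space. -/
theorem partialDeriv_mollify {f : Rn n → Rn 3} {g : Fin n → Rn n → Rn 3}
    (hf : HasL2WeakGradient univ f g) (j : ℕ) (i : Fin n) :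
    partialDeriv i (mollify j f) = mollify j (g i) := by
  have hf2 : MemLp f 2 volume := by simpa using hf.1
  set ρ := (mollifierBump n j).normed volume with hρ
  have hρc : ContDiff ℝ ∞ ρ := (mollifierBump n j).contDiff_normed
  have hρs : HasCompactSupport ρ := (mollifierBump n j).hasCompactSupport_normed
  have hl : LocallyIntegrable f volume := hf2.locallyIntegrable (by norm_num)
  funext x
  have hd := (hρs.hasFDerivAt_convolution_left (ContinuousLinearMap.lsmul ℝ ℝ)
    (hρc.of_le (by simp)) hl x).fderiv
  -- the weak gradient is tested with the reflected and translated kernel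
  have hψc : ContDiff ℝ ∞ fun y => ρ (x - y) := hρc.comp (contDiff_const.sub contDiff_id)
  have hψ : IsTestFunction univ fun y => ρ (x - y) :=
    ⟨hψc, hρs.comp_homeomorph (Homeomorph.subLeft x), subset_univ _⟩
  have key := hf.2.2.integral_eq hψ i
  have hpd (y : Rn n) : partialDeriv i (fun y => ρ (x - y)) y =
      - fderiv ℝ ρ (x - y) (EuclideanSpace.single i 1) := by
    have h1 : HasFDerivAt ρ (fderiv ℝ ρ (x - y)) (x - y) :=
      (hρc.differentiable (by simp) _).hasFDerivAt
    have h2 := h1.comp y ((hasFDerivAt_id y).const_sub x)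
    have h3 : fderiv ℝ (fun y => ρ (x - y)) y = _ := h2.fderiv
    rw [partialDeriv, h3]
    simp
  simp only [hpd, neg_smul, integral_neg, neg_inj] at key
  have hL : mollify j (g i) x = ∫ y, ρ (x - y) • g i y := by
    rw [mollify, convolution_eq_swap]
    rfl
  have hfd : HasCompactSupport (fderiv ℝ ρ) := hρs.fderiv ℝ
  have hR : ConvolutionExistsAt (fderiv ℝ ρ) f x
      ((ContinuousLinearMap.lsmul ℝ ℝ).precompL (Rn n)) volume :=
    hfd.convolutionExists_left _ (hρc.continuous_fderiv (by simp)) hl x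
  rw [hL, ← key, partialDeriv]
  change fderiv ℝ (ρ ⋆[ContinuousLinearMap.lsmul ℝ ℝ, volume] f) x _ = _
  rw [hd, convolution_eq_swap]
  rw [ConvolutionExistsAt] at hR
  have hR' := hR.comp_sub_left x
  rw [ContinuousLinearMap.integral_apply]
  · rfl
  · simpa using hR'

theorem exists_isTestFunction_eq_one {Ω K : Set (Rn n)} (hΩ : IsOpen Ω) (hK : IsCompact K)
    (hKΩ : K ⊆ Ω) :
    ∃ χ : Rn n → ℝ, IsTestFunction Ω χ ∧ (∀ᶠ x in 𝓝ˢ K, χ x = 1) ∧ ∀ x, χ x ∈ Icc (0 : ℝ) 1 := by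
  obtain ⟨L, hL, hKL, hLΩ⟩ := exists_compact_between hK hΩ hKΩ
  obtain ⟨χ, h1, h0, h01⟩ := exists_contMDiffMap_one_nhds_of_subset_interior (n := ⊤)
    (modelWithCornersSelf ℝ (Rn n)) hK.isClosed hKL
  have hs : tsupport χ ⊆ L := closure_minimal (fun x hx => by
    by_contra h
    exact hx (h0 x h)) hL.isClosed
  exact ⟨χ, ⟨χ.contMDiff.contDiff, hL.of_isClosed_subset isClosed_closure hs, hs.trans hLΩ⟩, h1,
    h01⟩

/-- Extension by zero of a map with compact support in `Ω`. -/
theorem HasL2WeakGradient.indicator {Ω K : Set (Rn n)} {f : Rn n → Rn 3}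
    {g : Fin n → Rn n → Rn 3} (hf : HasL2WeakGradient Ω f g) (hΩ : IsOpen Ω) (hK : IsCompact K)
    (hKΩ : K ⊆ Ω) (h0 : ∀ x, x ∉ K → f x = 0) (h1 : ∀ i x, x ∉ K → g i x = 0) :
    HasL2WeakGradient univ f g := by
  have hm {k : Rn n → Rn 3} (hk : MemLp k 2 (volume.restrict Ω)) (hk0 : ∀ x, x ∉ K → k x = 0) :
      MemLp k 2 (volume.restrict univ) := by
    have e : Ω.indicator k = k := by
      rw [indicator_eq_self]
      intro x hx
      by_contra h
      exact hx (hk0 x fun hxK => h (hKΩ hxK))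
    rw [← memLp_indicator_iff_restrict hΩ.measurableSet, e] at hk
    rwa [Measure.restrict_univ]
  have hf0 := hm hf.1 h0
  have hg0 i := hm (hf.2.1 i) (h1 i)
  refine ⟨hf0, hg0, hasWeakGradient_iff.2 ⟨hf0.locallyIntegrableOn_of_restrict,
    fun i => (hg0 i).locallyIntegrableOn_of_restrict, fun φ hφ i => ?_⟩⟩
  obtain ⟨χ, hχ, hχ1, -⟩ := exists_isTestFunction_eq_one hΩ hK hKΩ
  have hφχ : IsTestFunction Ω fun x => χ x * φ x :=
    ⟨hχ.1.mul hφ.1, hχ.2.1.mul_right, tsupport_mul_subset_left.trans hχ.2.2⟩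
  have key := hf.2.2.integral_eq hφχ i
  have e1 : ∀ x, partialDeriv i (fun x => χ x * φ x) x • f x = partialDeriv i φ x • f x := by
    intro x
    by_cases hx : x ∈ K
    · have hx1 : χ =ᶠ[𝓝 x] fun _ => 1 := (eventually_nhdsSet_iff_forall.1 hχ1) x hx
      have hx2 : (fun x => χ x * φ x) =ᶠ[𝓝 x] φ := hx1.mono fun y hy => by simp [hy]
      rw [partialDeriv, hx2.fderiv_eq, partialDeriv]
    · simp [h0 x hx]
  have e2 : ∀ x, (χ x * φ x) • g i x = φ x • g i x := by
    intro x
    by_cases hx : x ∈ K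
    · rw [hχ1.self_of_nhdsSet x hx, one_mul]
    · simp [h1 i x hx]
  simpa only [e1, e2] using key

/-- Near a compact subset of `Ω`, a map of `W^{1,2}(Ω)` is the limit in `W^{1,2}` of smooth
maps. -/
theorem HasL2WeakGradient.exists_contDiff_tendsto {Ω K : Set (Rn n)} {f : Rn n → Rn 3}
    {g : Fin n → Rn n → Rn 3} (hf : HasL2WeakGradient Ω f g) (hΩ : IsOpen Ω) (hK : IsCompact K)
    (hKΩ : K ⊆ Ω) :
    ∃ F : ℕ → Rn n → Rn 3, (∀ j, ContDiff ℝ ∞ (F j)) ∧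
      Tendsto (fun j => eLpNorm (F j - f) 2 (volume.restrict K)) atTop (𝓝 0) ∧
      ∀ i, Tendsto (fun j => eLpNorm (partialDeriv i (F j) - g i) 2 (volume.restrict K)) atTop
        (𝓝 0) := by
  -- the approximations are mollifications of `χ • f`, extended by zero, with a cutoff `χ = 1` near
  -- `K`
  obtain ⟨χ, hχ, hχ1, hχ01⟩ := exists_isTestFunction_eq_one hΩ hK hKΩ
  obtain ⟨C, hC⟩ := (hχ.2.1.fderiv ℝ).exists_bound_of_continuous
    (hχ.1.continuous_fderiv (by simp))
  have h1 := (hf.smul hχ.1 hΩ (C := 1) (fun x => by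
    rw [Real.norm_of_nonneg (hχ01 x).1]; exact (hχ01 x).2) hC).indicator hΩ hχ.2.1 hχ.2.2
    (fun x hx => by simp [image_eq_zero_of_notMem_tsupport hx])
    (fun i x hx => by
      simp [image_eq_zero_of_notMem_tsupport hx, partialDeriv_eq_zero_of_notMem_tsupport hx])
  have hlim {k k' : Rn n → Rn 3} (hk : MemLp k 2 (volume.restrict univ))
      (hkk : ∀ x ∈ K, k x = k' x) :
      Tendsto (fun j => eLpNorm (mollify j k - k') 2 (volume.restrict K)) atTop (𝓝 0) := by
    rw [Measure.restrict_univ] at hk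
    refine tendsto_of_tendsto_of_tendsto_of_le_of_le tendsto_const_nhds
      (tendsto_eLpNorm_mollify_sub hk) (fun _ => zero_le) fun j => ?_
    calc eLpNorm (mollify j k - k') 2 (volume.restrict K)
        = eLpNorm (mollify j k - k) 2 (volume.restrict K) := by
          refine eLpNorm_congr_ae (ae_restrict_of_forall_mem hK.measurableSet fun x hx => ?_)
          simp [hkk x hx]
      _ ≤ _ := eLpNorm_mono_measure _ Measure.restrict_le_self
  refine ⟨fun j => mollify j fun x => χ x • f x,
    fun j => contDiff_mollify j (by simpa using h1.1),
    hlim h1.1 fun x hx => by rw [hχ1.self_of_nhdsSet x hx, one_smul], fun i => ?_⟩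
  simp only [partialDeriv_mollify h1]
  refine hlim (h1.2.1 i) fun x hx => ?_
  have hx1 : χ =ᶠ[𝓝 x] fun _ => 1 := (eventually_nhdsSet_iff_forall.1 hχ1) x hx
  have hx2 : partialDeriv i χ x = 0 := by rw [partialDeriv, hx1.fderiv_eq]; simp
  rw [hx2, hχ1.self_of_nhdsSet x hx, zero_smul, one_smul, zero_add]

end Mollification

/-! ### Chain rule and limits of weak gradients -/

section ChainRule

open Filter Topology

variable {n : ℕ} {Ω : Set (Rn n)}

theorem locallyIntegrableOn_of_norm_le {f : Rn n → Rn 3} {b : Rn n → ℝ}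
    (hb : LocallyIntegrableOn b Ω volume) (hf : AEStronglyMeasurable f (volume.restrict Ω))
    (h : ∀ᵐ x ∂volume.restrict Ω, ‖f x‖ ≤ b x) : LocallyIntegrableOn f Ω volume := by
  intro x hx
  obtain ⟨t, ht, hi⟩ := hb x hx
  refine ⟨t ∩ Ω, inter_mem ht self_mem_nhdsWithin, ?_⟩
  have hr : volume.restrict (t ∩ Ω) ≤ volume.restrict Ω :=
    Measure.restrict_mono_set _ inter_subset_right
  refine (hi.mono_set inter_subset_left).mono' (hf.mono_measure hr) ?_
  exact (ae_mono hr) h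

/-- Weak gradients pass to dominated almost everywhere limits. -/
theorem hasWeakGradient_of_dominated_limit {u : ℕ → Rn n → Rn 3} {g : ℕ → Fin n → Rn n → Rn 3}
    {u' : Rn n → Rn 3} {g' : Fin n → Rn n → Rn 3} {b : Rn n → ℝ} {c : Fin n → Rn n → ℝ}
    (hu : ∀ m, HasWeakGradient Ω (u m) (g m))
    (hb : LocallyIntegrableOn b Ω volume) (hc : ∀ i, LocallyIntegrableOn (c i) Ω volume)
    (hub : ∀ m, ∀ᵐ x ∂volume.restrict Ω, ‖u m x‖ ≤ b x)
    (hgc : ∀ m i, ∀ᵐ x ∂volume.restrict Ω, ‖g m i x‖ ≤ c i x)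
    (hlim : ∀ᵐ x ∂volume.restrict Ω, Tendsto (fun m => u m x) atTop (𝓝 (u' x)))
    (hglim : ∀ i, ∀ᵐ x ∂volume.restrict Ω, Tendsto (fun m => g m i x) atTop (𝓝 (g' i x))) :
    HasWeakGradient Ω u' g' := by
  have hl {f : ℕ → Rn n → Rn 3} {f' : Rn n → Rn 3} {b : Rn n → ℝ}
      (hf : ∀ m, LocallyIntegrableOn (f m) Ω volume) (hb : LocallyIntegrableOn b Ω volume)
      (hfb : ∀ m, ∀ᵐ x ∂volume.restrict Ω, ‖f m x‖ ≤ b x)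
      (hlim : ∀ᵐ x ∂volume.restrict Ω, Tendsto (fun m => f m x) atTop (𝓝 (f' x))) :
      LocallyIntegrableOn f' Ω volume := by
    refine locallyIntegrableOn_of_norm_le hb
      (aestronglyMeasurable_of_tendsto_ae atTop (fun m => (hf m).aestronglyMeasurable) hlim) ?_
    filter_upwards [hlim, ae_all_iff.2 hfb] with x hx hxb
    exact le_of_tendsto hx.norm (.of_forall hxb)
  have hi {f : ℕ → Rn n → Rn 3} {f' : Rn n → Rn 3} {b : Rn n → ℝ} {φ : Rn n → ℝ}
      {K : Set (Rn n)} (hK : IsCompact K) (hKΩ : K ⊆ Ω) (hφ : Continuous φ)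
      (hφK : ∀ x, x ∉ K → φ x = 0)
      (hf : ∀ m, LocallyIntegrableOn (f m) Ω volume) (hb : LocallyIntegrableOn b Ω volume)
      (hfb : ∀ m, ∀ᵐ x ∂volume.restrict Ω, ‖f m x‖ ≤ b x)
      (hlim : ∀ᵐ x ∂volume.restrict Ω, Tendsto (fun m => f m x) atTop (𝓝 (f' x))) :
      Tendsto (fun m => ∫ x in Ω, φ x • f m x) atTop (𝓝 (∫ x in Ω, φ x • f' x)) := by
    refine tendsto_integral_of_dominated_convergence (fun x => ‖φ x‖ • b x)
      (fun m => hφ.aestronglyMeasurable.smul (hf m).aestronglyMeasurable) ?_ ?_ ?_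
    · exact (hb.integrable_smul_of_tsupport hφ.norm hK hKΩ fun x hx => by
        simp [hφK x hx]).integrableOn
    · intro m
      filter_upwards [hfb m] with x hx
      rw [norm_smul, smul_eq_mul]
      gcongr
    · filter_upwards [hlim] with x hx
      exact hx.const_smul _
  refine ⟨hl (fun m => (hu m).1) hb hub hlim,
    fun i => hl (fun m => (hu m).2.1 i) (hc i) (fun m => hgc m i) (hglim i), fun φ hφ i => ?_⟩
  have h1 := hi hφ.2.1 hφ.2.2 (continuous_partialDeriv hφ.1 i)
    (fun x hx => partialDeriv_eq_zero_of_notMem_tsupport hx i) (fun m => (hu m).1) hb hub hlim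
  have h2 := hi hφ.2.1 hφ.2.2 hφ.1.continuous IsTestFunction.eq_zero (fun m => (hu m).2.1 i)
    (hc i) (fun m => hgc m i) (hglim i)
  exact tendsto_nhds_unique h1 (h2.neg.congr fun m => ((hu m).2.2 φ hφ i).symm)

/-- On a compact set, integrals of functions that are pointwise `O(‖f j‖)` tend to `0` when
`f j → 0` in `L²`. -/
theorem tendsto_setIntegral_zero_of_eLpNorm_two {K : Set (Rn n)} (hK : IsCompact K)
    {F : Type*} [NormedAddCommGroup F] [NormedSpace ℝ F]
    {f : ℕ → Rn n → Rn 3} {a : ℕ → Rn n → F} {C : ℝ}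
    (hf : ∀ j, AEStronglyMeasurable (f j) (volume.restrict K))
    (h : Tendsto (fun j => eLpNorm (f j) 2 (volume.restrict K)) atTop (𝓝 0))
    (ha : ∀ j x, ‖a j x‖ ≤ C * ‖f j x‖) :
    Tendsto (fun j => ∫ x in K, a j x) atTop (𝓝 0) := by
  rw [tendsto_zero_iff_enorm_tendsto_zero]
  set M : ℝ≥0∞ := volume.restrict K univ ^ (1 / (1 : ℝ≥0∞).toReal - 1 / (2 : ℝ≥0∞).toReal)
  have hM : M ≠ ⊤ := by
    refine ENNReal.rpow_ne_top_of_nonneg (by norm_num) ?_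
    simpa using hK.measure_lt_top.ne
  refine tendsto_of_tendsto_of_tendsto_of_le_of_le tendsto_const_nhds
    (h := fun j => ENNReal.ofReal C * (eLpNorm (f j) 2 (volume.restrict K) * M)) ?_
    (fun _ => zero_le) fun j => ?_
  · have := ENNReal.Tendsto.const_mul (a := ENNReal.ofReal C)
      (ENNReal.Tendsto.mul_const h (.inr hM)) (.inr ENNReal.ofReal_ne_top)
    simpa using this
  · calc ‖∫ x in K, a j x‖ₑ ≤ ∫⁻ x in K, ‖a j x‖ₑ := enorm_integral_le_lintegral_enorm _
      _ = eLpNorm (a j) 1 (volume.restrict K) := eLpNorm_one_eq_lintegral_enorm.symm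
      _ ≤ ENNReal.ofReal C * eLpNorm (f j) 1 (volume.restrict K) :=
        eLpNorm_le_mul_eLpNorm_of_ae_le_mul (.of_forall (ha j)) 1
      _ ≤ _ := by
        exact mul_le_mul' le_rfl (eLpNorm_le_eLpNorm_mul_rpow_measure_univ (by norm_num) (hf j))

/-- Chain rule for a bounded `C¹` function with bounded derivative. -/
theorem HasL2WeakGradient.comp_contDiff {w : Rn n → Rn 3} {g : Fin n → Rn n → Rn 3}
    (hw : HasL2WeakGradient Ω w g) (hΩ : IsOpen Ω) {Φ : Rn 3 → Rn 3} (hΦ : ContDiff ℝ 1 Φ)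
    {C₀ C : ℝ} (h0 : ∀ y, ‖Φ y‖ ≤ C₀) (h1 : ∀ y, ‖fderiv ℝ Φ y‖ ≤ C) :
    HasWeakGradient Ω (fun x => Φ (w x)) (fun i x => fderiv ℝ Φ (w x) (g i x)) := by
  have hC : 0 ≤ C := (norm_nonneg _).trans (h1 0)
  have hΦ' : Continuous (fderiv ℝ Φ) := hΦ.continuous_fderiv (by simp)
  have hle (y z : Rn 3) : ‖fderiv ℝ Φ y z‖ ≤ C * ‖z‖ := (fderiv ℝ Φ y).le_of_opNorm_le (h1 y) z
  have hlip (y z : Rn 3) : ‖Φ y - Φ z‖ ≤ C * ‖y - z‖ :=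
    convex_univ.norm_image_sub_le_of_norm_fderiv_le
      (fun x _ => hΦ.differentiable (by simp) x) (fun x _ => h1 x) (mem_univ _) (mem_univ _)
  have hm {y z : Rn n → Rn 3} {μ : Measure (Rn n)} (hy : AEStronglyMeasurable y μ)
      (hz : AEStronglyMeasurable z μ) :
      AEStronglyMeasurable (fun x => fderiv ℝ Φ (y x) (z x)) μ :=
    (isBoundedBilinearMap_apply (𝕜 := ℝ) (E := Rn 3) (F := Rn 3)).continuous.comp_aestronglyMeasurable
      ((hΦ'.comp_aestronglyMeasurable hy).prodMk hz)
  have hwm : AEStronglyMeasurable (fun x => Φ (w x)) (volume.restrict Ω) :=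
    hΦ.continuous.comp_aestronglyMeasurable hw.1.1
  have hgm (i : Fin n) : AEStronglyMeasurable (fun x => fderiv ℝ Φ (w x) (g i x))
      (volume.restrict Ω) := hm hw.1.1 (hw.2.1 i).1
  have hl0 : LocallyIntegrableOn (fun x => Φ (w x)) Ω volume :=
    locallyIntegrableOn_of_norm_le ((locallyIntegrable_const C₀).locallyIntegrableOn Ω) hwm
      (.of_forall fun x => h0 _)
  have hl1 (i : Fin n) : LocallyIntegrableOn (fun x => fderiv ℝ Φ (w x) (g i x)) Ω volume :=
    ((hw.2.1 i).of_le_mul (hgm i) (.of_forall fun x => hle _ _)).locallyIntegrableOn_of_restrict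
  refine hasWeakGradient_iff.2 ⟨hl0, hl1, fun φ hφ i => ?_⟩
  set K := tsupport φ with hKdef
  have hK : IsCompact K := hφ.2.1
  have hKΩ : K ⊆ Ω := hφ.2.2
  have hμ : volume.restrict K ≤ volume.restrict Ω := Measure.restrict_mono_set _ hKΩ
  obtain ⟨F, hFs, hF, hFi⟩ := hw.exists_contDiff_tendsto hΩ hK hKΩ
  have hFm j : AEStronglyMeasurable (F j) (volume.restrict K) :=
    (hFs j).continuous.aestronglyMeasurable
  have hFim j : AEStronglyMeasurable (partialDeriv i (F j)) (volume.restrict K) :=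
    (continuous_partialDeriv (hFs j) i).aestronglyMeasurable
  obtain ⟨ns, hns, hae⟩ := (tendstoInMeasure_of_tendsto_eLpNorm two_ne_zero hFm
    (hw.1.1.mono_measure hμ) hF).exists_seq_tendsto_ae
  replace hF := hF.comp hns.tendsto_atTop
  replace hFi := (hFi i).comp hns.tendsto_atTop
  have hφi := continuous_partialDeriv hφ.1 i
  have hφ0 : ∀ x, x ∉ K → partialDeriv i φ x = 0 :=
    fun x hx => partialDeriv_eq_zero_of_notMem_tsupport hx i
  obtain ⟨M, hM⟩ := hφ.2.1.exists_bound_of_continuous hφ.1.continuous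
  obtain ⟨M', hM'⟩ := (hasCompactSupport_partialDeriv hφ.2.1 i).exists_bound_of_continuous hφi
  have hM0 : 0 ≤ M := (norm_nonneg _).trans (hM 0)
  have hM0' : 0 ≤ M' := (norm_nonneg _).trans (hM' 0)
  -- integration by parts for the smooth approximations
  have hibp j : ∫ x in K, partialDeriv i φ x • Φ (F j x) =
      - ∫ x in K, φ x • fderiv ℝ Φ (F j x) (partialDeriv i (F j) x) := by
    have hd : ContDiff ℝ 1 fun x => Φ (F j x) := hΦ.comp ((hFs j).of_le (by simp))
    have he x : fderiv ℝ (fun x => Φ (F j x)) x (EuclideanSpace.single i 1) =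
        fderiv ℝ Φ (F j x) (partialDeriv i (F j) x) := by
      have := ((hΦ.differentiable (by simp) (F j x)).hasFDerivAt.comp x
        ((hFs j).differentiable (by simp) x).hasFDerivAt).fderiv
      change fderiv ℝ (Φ ∘ F j) x _ = _
      rw [this]
      rfl
    rw [setIntegral_smul_of_tsupport _ subset_rfl hφ0,
      setIntegral_smul_of_tsupport _ subset_rfl IsTestFunction.eq_zero]
    simp only [← he]
    rw [integral_smul_fderiv_eq_neg_fderiv_smul_of_integrable, neg_neg]
    · rfl
    · exact (hφi.smul hd.continuous).integrable_of_hasCompactSupport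
        ((hasCompactSupport_partialDeriv hφ.2.1 i).smul_right)
    · exact (hφ.1.continuous.smul ((hd.continuous_fderiv (by simp)).clm_apply
        continuous_const)).integrable_of_hasCompactSupport hφ.2.1.smul_right
    · exact (hφ.1.continuous.smul hd.continuous).integrable_of_hasCompactSupport
        hφ.2.1.smul_right
    · exact fun x _ => hφ.1.differentiable (by simp) x
    · exact fun x _ => hd.differentiable (by simp) x
  have iK {f : Rn n → Rn 3} (hf : LocallyIntegrableOn f Ω volume) {ψ : Rn n → ℝ}
      (hψ : Continuous ψ) : IntegrableOn (fun x => ψ x • f x) K := by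
    exact (hf.integrableOn_compact_subset hKΩ hK).continuousOn_smul hψ.continuousOn hK
  have iC {f : Rn n → Rn 3} (hf : Continuous f) {ψ : Rn n → ℝ}
      (hψ : Continuous ψ) : IntegrableOn (fun x => ψ x • f x) K :=
    (hψ.smul hf).continuousOn.integrableOn_compact hK
  -- both sides converge along the subsequence; on the right the derivative of `Φ` and the gradient
  -- of the approximation are replaced one after the other
  have L1 : Tendsto (fun j => ∫ x in K, partialDeriv i φ x • Φ (F (ns j) x)) atTop
      (𝓝 (∫ x in K, partialDeriv i φ x • Φ (w x))) := by
    rw [← tendsto_sub_nhds_zero_iff]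
    have := tendsto_setIntegral_zero_of_eLpNorm_two hK (C := M' * C)
      (a := fun j x => partialDeriv i φ x • (Φ (F (ns j) x) - Φ (w x)))
      (fun j => (hFm (ns j)).sub (hw.1.1.mono_measure hμ)) hF (fun j x => by
        rw [norm_smul, mul_assoc]
        exact mul_le_mul (hM' x) (hlip _ _) (norm_nonneg _) hM0')
    refine this.congr fun j => ?_
    simp only [smul_sub]
    exact integral_sub (iC (hΦ.continuous.comp (hFs _).continuous) hφi) (iK hl0 hφi)
  have hj1 j : Continuous fun x => fderiv ℝ Φ (F j x) (partialDeriv i (F j) x) :=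
    (hΦ'.comp (hFs j).continuous).clm_apply (continuous_partialDeriv (hFs j) i)
  have hgi : LocallyIntegrableOn (g i) Ω volume := hw.2.2.2.1 i
  have hj2 j : LocallyIntegrableOn (fun x => fderiv ℝ Φ (F j x) (g i x)) Ω volume :=
    ((hw.2.1 i).of_le_mul (hm (hFs j).continuous.aestronglyMeasurable (hw.2.1 i).1)
      (.of_forall fun x => hle _ _)).locallyIntegrableOn_of_restrict
  have L2 : Tendsto (fun j => ∫ x in K, φ x • fderiv ℝ Φ (F (ns j) x)
      (partialDeriv i (F (ns j)) x - g i x)) atTop (𝓝 0) :=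
    tendsto_setIntegral_zero_of_eLpNorm_two hK (C := M * C)
      (fun j => (hFim (ns j)).sub ((hw.2.1 i).1.mono_measure hμ)) hFi (fun j x => by
        rw [norm_smul, mul_assoc]
        exact mul_le_mul (hM x) (hle _ _) (norm_nonneg _) hM0)
  have L3 : Tendsto (fun j => ∫ x in K, φ x • fderiv ℝ Φ (F (ns j) x) (g i x)) atTop
      (𝓝 (∫ x in K, φ x • fderiv ℝ Φ (w x) (g i x))) := by
    refine tendsto_integral_of_dominated_convergence (fun x => M * (C * ‖g i x‖))
      (fun j => (iK (hj2 (ns j)) hφ.1.continuous).1)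
      (((hgi.integrableOn_compact_subset hKΩ hK).norm.const_mul C).const_mul M)
      (fun j => .of_forall fun x => ?_) ?_
    · rw [norm_smul]
      exact mul_le_mul (hM x) (hle _ _) (norm_nonneg _) hM0
    · filter_upwards [hae] with x hx
      exact (((hΦ'.clm_apply (continuous_const (y := g i x))).tendsto (w x)).comp hx).const_smul _
  have L4 := L2.add L3
  rw [zero_add] at L4
  rw [← setIntegral_smul_of_tsupport _ subset_rfl hφ0,
    ← setIntegral_smul_of_tsupport _ subset_rfl IsTestFunction.eq_zero]
  refine tendsto_nhds_unique L1 (L4.neg.congr fun j => ?_)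
  rw [hibp, ← integral_add _ (iK (hj2 (ns j)) hφ.1.continuous)]
  · congr 2
    funext x
    simp [smul_sub]
  · simp only [map_sub, smul_sub]
    exact (iC (hj1 (ns j)) hφ.1.continuous).sub (iK (hj2 (ns j)) hφ.1.continuous)

end ChainRule

/-! ### Weak closedness of `W_0^{1,2}` -/

section WeakClosure

open Filter Topology
open scoped RealInnerProductSpace

variable {n : ℕ} {Ω : Set (Rn n)}

/-- A closed subspace of a Hilbert space contains the weak limits of its bounded sequences; it
suffices to test weak convergence on a set `D` whose orthogonal complement is trivial. -/
theorem Submodule.mem_topologicalClosure_of_bounded_of_tendsto_inner {H : Type*}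
    [NormedAddCommGroup H] [InnerProductSpace ℝ H] [CompleteSpace H] (K : Submodule ℝ H)
    {X : ℕ → H} (hX : ∀ m, X m ∈ K) {F : H} {M : ℝ} (hM : ∀ m, ‖X m - F‖ ≤ M) {D : Set H}
    (hD : ∀ y, (∀ d ∈ D, ⟪d, y⟫ = 0) → y = 0)
    (hlim : ∀ d ∈ D, Tendsto (fun m => ⟪X m - F, d⟫) atTop (𝓝 0)) :
    F ∈ K.topologicalClosure := by
  -- the vectors along which the sequence converges weakly form a closed subspace containing `D`
  let S : Submodule ℝ H :=
    { carrier := {d | Tendsto (fun m => ⟪X m - F, d⟫) atTop (𝓝 0)}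
      add_mem' := fun {a b} ha hb => by
        have := Tendsto.add ha hb
        simpa [inner_add_right] using this
      zero_mem' := by simp
      smul_mem' := fun c a ha => by
        have := Tendsto.const_mul c ha
        simpa [inner_smul_right] using this }
  have hM0 : 0 ≤ M := (norm_nonneg _).trans (hM 0)
  have hSc : IsClosed (S : Set H) := by
    refine isClosed_of_closure_subset fun y hy => ?_
    change Tendsto _ _ _
    rw [Metric.tendsto_atTop]
    intro ε hε
    obtain ⟨d, hd, hyd⟩ := Metric.mem_closure_iff.1 hy (ε / (2 * (M + 1))) (by positivity)
    obtain ⟨N, hN⟩ := Metric.tendsto_atTop.1 hd (ε / 2) (by positivity)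
    refine ⟨N, fun m hm => ?_⟩
    have h1 := hN m hm
    rw [dist_zero_right] at h1 ⊢
    have h2 : ⟪X m - F, y⟫ = ⟪X m - F, d⟫ + ⟪X m - F, y - d⟫ := by
      rw [← inner_add_right]; congr 1; abel
    have h3 : ‖⟪X m - F, y - d⟫‖ ≤ (M + 1) * (ε / (2 * (M + 1))) :=
      (norm_inner_le_norm _ _).trans (mul_le_mul ((hM m).trans (by linarith))
        (by rw [← dist_eq_norm]; exact hyd.le) (norm_nonneg _) (by linarith))
    have h4 : (M + 1) * (ε / (2 * (M + 1))) = ε / 2 := by field_simp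
    rw [h2]
    exact (norm_add_le _ _).trans_lt (by linarith)
  have hST : S = ⊤ := by
    rw [← hSc.submodule_topologicalClosure_eq, Submodule.topologicalClosure_eq_top_iff,
      Submodule.eq_bot_iff]
    intro y hy
    exact hD y fun d hd => (Submodule.mem_orthogonal S y).1 hy d (hlim d hd)
  have hcl : IsClosed (K.topologicalClosure : Set H) := K.isClosed_topologicalClosure
  have : CompleteSpace K.topologicalClosure := hcl.completeSpace_coe
  rw [← Submodule.orthogonal_orthogonal K.topologicalClosure, Submodule.mem_orthogonal]
  intro R hR
  have hRS : R ∈ S := hST ▸ Submodule.mem_top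
  have h1 : ∀ m, ⟪X m - F, R⟫ = -⟪R, F⟫ := fun m => by
    rw [inner_sub_left, (Submodule.mem_orthogonal _ _).1 hR (X m)
      (K.le_topologicalClosure (hX m)), zero_sub, real_inner_comm]
  have h2 : Tendsto (fun m => ⟪X m - F, R⟫) atTop (𝓝 0) := hRS
  simp only [h1] at h2
  have := tendsto_nhds_unique h2 tendsto_const_nhds
  linarith

/-- The weak gradient of a test function is its classical gradient. -/
theorem IsTestFunction.hasL2WeakGradient {φ : Rn n → Rn 3} (hφ : IsTestFunction Ω φ) :
    HasL2WeakGradient Ω φ (fun i => partialDeriv i φ) := by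
  have h0 : MemLp φ 2 (volume.restrict Ω) :=
    (hφ.1.continuous.memLp_of_hasCompactSupport hφ.2.1).restrict _
  have h1 i : MemLp (partialDeriv i φ) 2 (volume.restrict Ω) :=
    ((continuous_partialDeriv hφ.1 i).memLp_of_hasCompactSupport
      (hasCompactSupport_partialDeriv hφ.2.1 i)).restrict _
  refine ⟨h0, h1, hasWeakGradient_iff.2 ⟨h0.locallyIntegrableOn_of_restrict,
    fun i => (h1 i).locallyIntegrableOn_of_restrict, fun ψ hψ i => ?_⟩⟩
  have := integral_smul_fderiv_eq_neg_fderiv_smul_of_integrable (μ := volume) (f := ψ) (g := φ)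
    (v := EuclideanSpace.single i 1)
    (((continuous_partialDeriv hψ.1 i).smul hφ.1.continuous).integrable_of_hasCompactSupport
      (hasCompactSupport_partialDeriv hψ.2.1 i).smul_right)
    ((hψ.1.continuous.smul (continuous_partialDeriv hφ.1 i)).integrable_of_hasCompactSupport
      hψ.2.1.smul_right)
    ((hψ.1.continuous.smul hφ.1.continuous).integrable_of_hasCompactSupport
      hψ.2.1.smul_right)
    (fun x _ => hψ.1.differentiable (by simp) x) (fun x _ => hφ.1.differentiable (by simp) x)
  rw [eq_comm, neg_eq_iff_eq_neg]
  exact this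

/-- The `1`-jet `(u, ∂_1 u, …, ∂_n u)` of a map with gradient `g`. -/
def jet (u : Rn n → Rn 3) (g : Fin n → Rn n → Rn 3) : Option (Fin n) → Rn n → Rn 3
  | none => u
  | some i => g i

theorem HasL2WeakGradient.memLp_jet {u : Rn n → Rn 3} {g : Fin n → Rn n → Rn 3}
    (hu : HasL2WeakGradient Ω u g) (o : Option (Fin n)) :
    MemLp (jet u g o) 2 (volume.restrict Ω) := by
  cases o with
  | none => exact hu.1
  | some i => exact hu.2.1 i

/-- The Hilbert space `L²(Ω)^{1+n}` of `1`-jets. -/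
abbrev JetSpace (Ω : Set (Rn n)) : Type :=
  PiLp 2 fun _ : Option (Fin n) => Lp (Rn 3) 2 (volume.restrict Ω)

/-- The `1`-jet of a map of `W^{1,2}(Ω)`, as an element of `L²(Ω)^{1+n}`. -/
noncomputable def HasL2WeakGradient.toJet {u : Rn n → Rn 3} {g : Fin n → Rn n → Rn 3}
    (hu : HasL2WeakGradient Ω u g) : JetSpace Ω :=
  WithLp.toLp 2 fun o => (hu.memLp_jet o).toLp (jet u g o)

/-- The jets of test functions. -/
noncomputable def testJets (Ω : Set (Rn n)) : Submodule ℝ (JetSpace Ω) where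
  carrier := {X | ∃ (φ : Rn n → Rn 3) (hφ : IsTestFunction Ω φ), X = hφ.hasL2WeakGradient.toJet}
  add_mem' := by
    rintro _ _ ⟨φ, hφ, rfl⟩ ⟨ψ, hψ, rfl⟩
    have h : IsTestFunction Ω (φ + ψ) := ⟨hφ.1.add hψ.1, hφ.2.1.add hψ.2.1,
      (tsupport_add φ ψ).trans (union_subset hφ.2.2 hψ.2.2)⟩
    refine ⟨φ + ψ, h, ?_⟩
    ext1 o
    simp only [HasL2WeakGradient.toJet, PiLp.add_apply]
    rw [← MemLp.toLp_add, MemLp.toLp_eq_toLp_iff]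
    refine .of_forall fun x => ?_
    cases o with
    | none => rfl
    | some i =>
      simp [jet, partialDeriv, fderiv_add (hφ.1.differentiable (by simp) x)
        (hψ.1.differentiable (by simp) x)]
  zero_mem' := by
    refine ⟨0, ⟨contDiff_const, HasCompactSupport.zero, by simp [tsupport]⟩, ?_⟩
    ext1 o
    simp only [HasL2WeakGradient.toJet, PiLp.zero_apply]
    rw [eq_comm, ← MemLp.toLp_zero (MemLp.zero' (p := 2) (μ := volume.restrict Ω)),
      MemLp.toLp_eq_toLp_iff]
    refine .of_forall fun x => ?_
    cases o with
    | none => rfl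
    | some i => simp [jet, partialDeriv]
  smul_mem' := by
    rintro c _ ⟨φ, hφ, rfl⟩
    have h : IsTestFunction Ω (c • φ) := ⟨hφ.1.const_smul c, hφ.2.1.smul_left (f := fun _ => c),
      (tsupport_smul_subset_right (fun _ => c) φ).trans hφ.2.2⟩
    refine ⟨c • φ, h, ?_⟩
    ext1 o
    simp only [HasL2WeakGradient.toJet, PiLp.smul_apply]
    rw [← MemLp.toLp_const_smul, MemLp.toLp_eq_toLp_iff]
    refine .of_forall fun x => ?_
    cases o with
    | none => rfl
    | some i => simp [jet, partialDeriv, fderiv_const_smul (hφ.1.differentiable (by simp) x)]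

theorem memW012_of_toJet_mem {u : Rn n → Rn 3} {g : Fin n → Rn n → Rn 3}
    (hu : HasL2WeakGradient Ω u g) (h : hu.toJet ∈ (testJets Ω).topologicalClosure) :
    MemW012 Ω u := by
  refine ⟨g, hu, fun ε hε => ?_⟩
  obtain ⟨_, ⟨φ, hφ, rfl⟩, hlt⟩ := EMetric.mem_closure_iff.1 h ε hε
  have key (o : Option (Fin n)) :
      eLpNorm (jet u g o - jet φ (fun i => partialDeriv i φ) o) 2 (volume.restrict Ω) < ε := by
    rw [← Lp.edist_toLp_toLp _ _ (hu.memLp_jet o) (hφ.hasL2WeakGradient.memLp_jet o)]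
    refine lt_of_le_of_lt ?_ hlt
    exact PiLp.edist_apply_le hu.toJet hφ.hasL2WeakGradient.toJet o
  exact ⟨φ, hφ, key none, fun i => key (some i)⟩

theorem memLp_smul_const_of_hasCompactSupport {μ : Measure (Rn n)} [IsFiniteMeasureOnCompacts μ]
    {η : Rn n → ℝ} (hη : Continuous η) (hs : HasCompactSupport η) (e : Rn 3) :
    MemLp (fun x => η x • e) 2 μ :=
  (hη.smul continuous_const).memLp_of_hasCompactSupport hs.smul_right

theorem inner_toLp_smul_const {k : Rn n → Rn 3} (hk : MemLp k 2 (volume.restrict Ω))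
    {η : Rn n → ℝ} (hη : Continuous η) (hs : HasCompactSupport η) (e : Rn 3)
    (hm : MemLp (fun x => η x • e) 2 (volume.restrict Ω)) :
    ⟪hk.toLp k, hm.toLp _⟫ = ⟪∫ x in Ω, η x • k x, e⟫ := by
  have hi : Integrable (fun x => η x • k x) (volume.restrict Ω) :=
    (hk.locallyIntegrable (by norm_num)).integrable_smul_left_of_hasCompactSupport hη hs
  rw [L2.inner_def, real_inner_comm, ← integral_inner hi e]
  refine integral_congr_ae ?_
  filter_upwards [hk.coeFn_toLp, hm.coeFn_toLp] with x h1 h2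
  rw [h1, h2, inner_smul_right, real_inner_comm, inner_smul_right]

/-- `W_0^{1,2}(Ω)` contains the `L²`-limits in `W^{1,2}(Ω)` of sequences of test functions that are
bounded in `W^{1,2}(Ω)`. -/
theorem memW012_of_bounded_of_tendsto {f : Rn n → Rn 3} {g : Fin n → Rn n → Rn 3}
    (hΩ : IsOpen Ω) (hf : HasL2WeakGradient Ω f g) {φ : ℕ → Rn n → Rn 3}
    (hφ : ∀ m, IsTestFunction Ω (φ m))
    (hlim : Tendsto (fun m => eLpNorm (φ m - f) 2 (volume.restrict Ω)) atTop (𝓝 0))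
    {M : ℝ≥0∞} (hM : M ≠ ⊤) (hM0 : ∀ m, eLpNorm (φ m) 2 (volume.restrict Ω) ≤ M)
    (hM1 : ∀ m i, eLpNorm (partialDeriv i (φ m)) 2 (volume.restrict Ω) ≤ M) :
    MemW012 Ω f := by
  have hj m := (hφ m).hasL2WeakGradient
  have hjf m := (hj m).sub hf
  have hMj m (o : Option (Fin n)) : ‖(hj m).toJet o‖ ≤ M.toReal := by
    rw [HasL2WeakGradient.toJet, Lp.norm_toLp]
    refine ENNReal.toReal_mono hM ?_
    cases o with
    | none => exact hM0 m
    | some i => exact hM1 m i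
  have hMX m : ‖(hj m).toJet‖ ≤ √(∑ _o : Option (Fin n), M.toReal ^ 2) := by
    rw [PiLp.norm_eq_of_L2]
    gcongr with o
    exact hMj m o
  refine memW012_of_toJet_mem hf <|
    (testJets Ω).mem_topologicalClosure_of_bounded_of_tendsto_inner
    (X := fun m => (hj m).toJet) (fun m => ⟨_, hφ m, rfl⟩)
    (M := √(∑ _o : Option (Fin n), M.toReal ^ 2) + ‖hf.toJet‖)
    -- the functionals given by test functions in a single component of the jet
    (D := {d | ∃ (o : Option (Fin n)) (η : Rn n → ℝ) (e : Rn 3) (hη : IsTestFunction Ω η)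
      (hm : MemLp (fun x => η x • e) 2 (volume.restrict Ω)),
      d = WithLp.toLp 2 (Pi.single o (hm.toLp _))})
    (fun m => (norm_sub_le _ _).trans (by gcongr; exact hMX m)) ?_ ?_
  · intro Y hY
    ext1 o
    refine Lp.eq_zero_iff_ae_eq_zero.2 ?_
    rw [Filter.EventuallyEq, ae_restrict_iff' hΩ.measurableSet]
    refine hΩ.ae_eq_zero_of_integral_contDiff_smul_eq_zero
      (Lp.memLp (Y o)).locallyIntegrableOn_of_restrict fun η h1 h2 h3 => ?_
    refine ext_inner_right ℝ fun e => ?_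
    have hm : MemLp (fun x => η x • e) 2 (volume.restrict Ω) :=
      memLp_smul_const_of_hasCompactSupport h1.continuous h2 e
    have h4 := hY _ ⟨o, η, e, ⟨h1, h2, h3⟩, hm, rfl⟩
    rw [PiLp.inner_apply, Finset.sum_eq_single o (fun j _ hj => by simp [Pi.single_eq_of_ne hj])
      (by simp)] at h4
    simp only [Pi.single_eq_same] at h4
    rw [real_inner_comm, ← Lp.toLp_coeFn (Y o) (Lp.memLp _),
      inner_toLp_smul_const (Lp.memLp (Y o)) h1.continuous h2 e hm,
      setIntegral_smul_of_tsupport _ h3 fun x hx => image_eq_zero_of_notMem_tsupport hx] at h4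
    rw [h4, inner_zero_left]
  · rintro _ ⟨o, η, e, hη, hm, rfl⟩
    have hL2 (ζ : Rn n → ℝ) (hζ : MemLp (fun x => ζ x • e) 2 (volume.restrict Ω)) :
        Tendsto (fun m => ⟪(hjf m).1.toLp _, hζ.toLp _⟫) atTop (𝓝 0) := by
      refine squeeze_zero_norm (a := fun m =>
        (eLpNorm (φ m - f) 2 (volume.restrict Ω)).toReal * ‖hζ.toLp _‖) (fun m => ?_) ?_
      · refine (norm_inner_le_norm _ _).trans_eq ?_
        rw [Lp.norm_toLp]
      · have := ((ENNReal.tendsto_toReal ENNReal.zero_ne_top).comp hlim).mul_const ‖hζ.toLp _‖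
        simpa using this
    have hred m : ⟪(hj m).toJet - hf.toJet, WithLp.toLp 2 (Pi.single o (hm.toLp _))⟫ =
        ⟪((hjf m).memLp_jet o).toLp _, hm.toLp _⟫ := by
      rw [PiLp.inner_apply, Finset.sum_eq_single o
        (fun j _ hj => by simp [Pi.single_eq_of_ne hj]) (by simp)]
      simp only [Pi.single_eq_same]
      congr 1
      rw [PiLp.sub_apply, HasL2WeakGradient.toJet, HasL2WeakGradient.toJet]
      simp only
      rw [← MemLp.toLp_sub, MemLp.toLp_eq_toLp_iff]
      cases o <;> exact .of_forall fun x => rfl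
    simp only [hred]
    cases o with
    | none => exact hL2 η hm
    | some i =>
      -- integration by parts moves the derivative from `φ m - f` to `η`
      have hηi := continuous_partialDeriv hη.1 i
      have hηs := hasCompactSupport_partialDeriv hη.2.1 i
      have hm' : MemLp (fun x => partialDeriv i η x • e) 2 (volume.restrict Ω) :=
        memLp_smul_const_of_hasCompactSupport hηi hηs e
      have h5 := (hL2 _ hm').neg
      rw [neg_zero] at h5
      refine h5.congr fun m => ?_
      rw [inner_toLp_smul_const _ hηi hηs e hm', inner_toLp_smul_const _ hη.1.continuous hη.2.1,
        (hjf m).2.2.2.2 η hη i, inner_neg_left, neg_neg]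
      rfl

end WeakClosure

/-! ### Maps dominated by a map of `W_0^{1,2}` -/

section Domination

open Filter Topology
open scoped RealInnerProductSpace

variable {n : ℕ} {Ω : Set (Rn n)}

theorem exists_abs_deriv_smoothTransition_le : ∃ S : ℝ, 0 ≤ S ∧
    ∀ t, |deriv Real.smoothTransition t| ≤ S := by
  have hc : Continuous (deriv Real.smoothTransition) :=
    (Real.smoothTransition.contDiff (n := 1)).continuous_deriv le_rfl
  obtain ⟨S, hS⟩ := isCompact_Icc.exists_bound_of_continuousOn (s := Icc (0 : ℝ) 1) hc.continuousOn
  refine ⟨max S 0, le_max_right _ _, fun t => ?_⟩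
  by_cases ht : t ∈ Icc (0 : ℝ) 1
  · exact (hS t ht).trans (le_max_left _ _)
  · have : deriv Real.smoothTransition t = 0 := by
      rcases not_and_or.1 ht with h | h
      · have : Real.smoothTransition =ᶠ[𝓝 t] fun _ => 0 :=
          (eventually_lt_nhds (not_le.1 h)).mono fun s hs =>
            Real.smoothTransition.zero_of_nonpos hs.le
        rw [this.deriv_eq]; simp
      · have : Real.smoothTransition =ᶠ[𝓝 t] fun _ => 1 :=
          (eventually_gt_nhds (not_le.1 h)).mono fun s hs =>
            Real.smoothTransition.one_of_one_le hs.le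
        rw [this.deriv_eq]; simp
    rw [this, abs_zero]
    exact le_max_right _ _

theorem deriv_smoothTransition_of_one_lt {t : ℝ} (ht : 1 < t) :
    deriv Real.smoothTransition t = 0 := by
  have : Real.smoothTransition =ᶠ[𝓝 t] fun _ => 1 :=
    (eventually_gt_nhds ht).mono fun s hs => Real.smoothTransition.one_of_one_le hs.le
  rw [this.deriv_eq]; simp

/-- A smooth truncation of `y` at height `≈ l ‖z‖`: it vanishes for `z = 0` and tends to `y` as
`ε → 0` when `‖y‖ ≤ l ‖z‖`. -/
noncomputable def smoothTruncation (l ε : ℝ) (p : Rn 3 × Rn 3) : Rn 3 :=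
  Real.smoothTransition (l ^ 2 * ‖p.2‖ ^ 2 / (‖p.1‖ ^ 2 + ε ^ 2)) • p.1

theorem smoothTruncation_zero_right (l ε : ℝ) (y : Rn 3) : smoothTruncation l ε (y, 0) = 0 := by
  simp [smoothTruncation]

theorem norm_smoothTruncation_le (l ε : ℝ) (p : Rn 3 × Rn 3) :
    ‖smoothTruncation l ε p‖ ≤ ‖p.1‖ := by
  rw [smoothTruncation, norm_smul, Real.norm_of_nonneg (Real.smoothTransition.nonneg _)]
  exact mul_le_of_le_one_left (norm_nonneg _) (Real.smoothTransition.le_one _)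

theorem contDiff_smoothTruncation (l : ℝ) {ε : ℝ} (hε : 0 < ε) :
    ContDiff ℝ ∞ (smoothTruncation l ε) := by
  have : ContDiff ℝ ∞ fun p : Rn 3 × Rn 3 => l ^ 2 * ‖p.2‖ ^ 2 / (‖p.1‖ ^ 2 + ε ^ 2) :=
    (contDiff_const.mul (contDiff_snd.norm_sq ℝ)).div ((contDiff_fst.norm_sq ℝ).add contDiff_const)
      fun p => by positivity
  exact (Real.smoothTransition.contDiff.comp this).smul contDiff_fst

/-- The truncations are Lipschitz uniformly in `ε`. -/
theorem exists_norm_fderiv_smoothTruncation_le {l : ℝ} (hl : 0 ≤ l) : ∃ M : ℝ, 0 ≤ M ∧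
    ∀ ε : ℝ, 0 < ε → ∀ p q, ‖fderiv ℝ (smoothTruncation l ε) p q‖ ≤ M * (‖q.1‖ + ‖q.2‖) := by
  obtain ⟨S, hS0, hS⟩ := exists_abs_deriv_smoothTransition_le
  refine ⟨1 + S * (2 * l + 2), by positivity, fun ε hε p q => ?_⟩
  obtain ⟨y, z⟩ := p
  obtain ⟨v, w⟩ := q
  set Q : ℝ := ‖y‖ ^ 2 + ε ^ 2 with hQ
  have hQ0 : 0 < Q := by positivity
  set r : ℝ := l ^ 2 * ‖z‖ ^ 2 / Q with hr
  set r' : ℝ := (2 * l ^ 2 * ⟪z, w⟫ * Q - l ^ 2 * ‖z‖ ^ 2 * (2 * ⟪y, v⟫)) / Q ^ 2 with hr'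
  have hd : fderiv ℝ (smoothTruncation l ε) (y, z) (v, w) =
      Real.smoothTransition r • v + (deriv Real.smoothTransition r * r') • y := by
    have h2 : HasFDerivAt (fun p : Rn 3 × Rn 3 => ‖p.2‖ ^ 2) _ (y, z) :=
      (hasFDerivAt_snd (𝕜 := ℝ)).norm_sq
    have h1 : HasFDerivAt (fun p : Rn 3 × Rn 3 => ‖p.1‖ ^ 2) _ (y, z) :=
      (hasFDerivAt_fst (𝕜 := ℝ)).norm_sq
    have h3 := (h2.const_mul (l ^ 2)).mul
      ((hasDerivAt_inv hQ0.ne').comp_hasFDerivAt (y, z) (h1.add_const (ε ^ 2)))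
    have h4 : HasDerivAt Real.smoothTransition (deriv Real.smoothTransition r) r :=
      ((Real.smoothTransition.contDiff (n := 1)).differentiable (by simp) r).hasDerivAt
    have hfun : smoothTruncation l ε = fun p => Real.smoothTransition
        (l ^ 2 * ‖p.2‖ ^ 2 * (‖p.1‖ ^ 2 + ε ^ 2)⁻¹) • p.1 := by
      funext p
      rw [smoothTruncation, div_eq_mul_inv]
    rw [hr, div_eq_mul_inv] at h4
    have h5 := (h4.comp_hasFDerivAt (y, z) h3).smul (hasFDerivAt_fst (𝕜 := ℝ))
    rw [hfun]
    refine (congrArg (fun L => L (v, w)) h5.fderiv).trans ?_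
    simp only [add_apply, smul_apply,
      ContinuousLinearMap.smulRight_apply, ContinuousLinearMap.coe_fst',
      ContinuousLinearMap.comp_apply, Function.comp,
      ContinuousLinearMap.coe_snd', innerSL_apply_apply, smul_eq_mul, ← hQ]
    rw [← div_eq_mul_inv, ← hr]
    congr 2
    simp only [nsmul_eq_mul]
    rw [hr, hr']
    congr 1
    field_simp
    push_cast
    ring
  rw [hd]
  simp only
  have hs : ‖Real.smoothTransition r • v‖ ≤ ‖v‖ := by
    rw [norm_smul, Real.norm_of_nonneg (Real.smoothTransition.nonneg _)]
    exact mul_le_of_le_one_left (norm_nonneg _) (Real.smoothTransition.le_one _)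
  have hy2 : ‖y‖ ^ 2 ≤ Q := by rw [hQ]; nlinarith [sq_nonneg ε]
  have hmain : ‖(deriv Real.smoothTransition r * r') • y‖ ≤ S * (2 * l * ‖w‖ + 2 * ‖v‖) := by
    rw [norm_smul, norm_mul, mul_assoc]
    by_cases hr1 : 1 < r
    · rw [deriv_smoothTransition_of_one_lt hr1, norm_zero, zero_mul]
      positivity
    refine mul_le_mul (hS r) ?_ (by positivity) hS0
    have hz : l ^ 2 * ‖z‖ ^ 2 ≤ Q := by
      rw [not_lt, hr, div_le_one hQ0] at hr1
      exact hr1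
    have hzy : l * ‖z‖ * ‖y‖ ≤ Q := by nlinarith [sq_nonneg (l * ‖z‖ - ‖y‖)]
    have h1 : |⟪z, w⟫| ≤ ‖z‖ * ‖w‖ := abs_real_inner_le_norm z w
    have h2 : |⟪y, v⟫| ≤ ‖y‖ * ‖v‖ := abs_real_inner_le_norm y v
    rw [hr', Real.norm_eq_abs, abs_div, abs_of_pos (pow_pos hQ0 2), div_mul_eq_mul_div,
      div_le_iff₀ (pow_pos hQ0 2)]
    have h3 : |2 * l ^ 2 * ⟪z, w⟫ * Q - l ^ 2 * ‖z‖ ^ 2 * (2 * ⟪y, v⟫)| ≤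
        2 * l ^ 2 * (‖z‖ * ‖w‖) * Q + Q * (2 * (‖y‖ * ‖v‖)) := by
      refine (abs_sub _ _).trans (add_le_add ?_ ?_)
      · rw [abs_mul, abs_mul, abs_of_pos hQ0, abs_of_nonneg (by positivity : 0 ≤ 2 * l ^ 2)]
        gcongr
      · rw [abs_mul, abs_of_nonneg (by positivity : 0 ≤ l ^ 2 * ‖z‖ ^ 2), abs_mul, abs_two]
        gcongr
    calc _ ≤ (2 * l ^ 2 * (‖z‖ * ‖w‖) * Q + Q * (2 * (‖y‖ * ‖v‖))) * ‖y‖ := by gcongr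
      _ = 2 * l * ‖w‖ * (l * ‖z‖ * ‖y‖) * Q + 2 * ‖v‖ * ‖y‖ ^ 2 * Q := by ring
      _ ≤ 2 * l * ‖w‖ * Q * Q + 2 * ‖v‖ * Q * Q := by gcongr
      _ = _ := by ring
  refine (norm_add_le _ _).trans ((add_le_add hs hmain).trans ?_)
  have hw : 0 ≤ ‖w‖ := norm_nonneg w
  have hv : 0 ≤ ‖v‖ := norm_nonneg v
  nlinarith [mul_nonneg hS0 hw, mul_nonneg hS0 hv, mul_nonneg (mul_nonneg hS0 hl) hv,
    mul_nonneg (mul_nonneg hS0 hl) hw]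

theorem norm_smoothTruncation_sub_le {l M ε : ℝ} (hM : 0 ≤ M) (hε : 0 < ε)
    (h : ∀ p q, ‖fderiv ℝ (smoothTruncation l ε) p q‖ ≤ M * (‖q.1‖ + ‖q.2‖))
    (p q : Rn 3 × Rn 3) :
    ‖smoothTruncation l ε p - smoothTruncation l ε q‖ ≤
      2 * M * (‖p.1 - q.1‖ + ‖p.2 - q.2‖) := by
  have h1 : ∀ x, ‖fderiv ℝ (smoothTruncation l ε) x‖ ≤ 2 * M := fun x =>
    ContinuousLinearMap.opNorm_le_bound _ (by positivity) fun q => (h x q).trans (by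
      have h1 := norm_fst_le q
      have h2 := norm_snd_le q
      nlinarith)
  have h2 := convex_univ.norm_image_sub_le_of_norm_fderiv_le
      (fun x _ => (contDiff_smoothTruncation l hε).differentiable (by simp) x)
      (fun x _ => h1 x) (mem_univ q) (mem_univ p)
  refine h2.trans ?_
  gcongr
  rw [Prod.norm_def]
  exact max_le_add_of_nonneg (norm_nonneg _) (norm_nonneg _)

theorem tendsto_smoothTruncation {l : ℝ} {y z : Rn 3} (h : ‖y‖ ≤ l * ‖z‖) {ε : ℕ → ℝ}
    (hε : Tendsto ε atTop (𝓝 0)) :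
    Tendsto (fun m => smoothTruncation l (ε m) (y, z)) atTop (𝓝 y) := by
  by_cases hy : y = 0
  · simp [smoothTruncation, hy]
  have hy0 : 0 < ‖y‖ := norm_pos_iff.2 hy
  have h1 : Tendsto (fun m => l ^ 2 * ‖z‖ ^ 2 / (‖y‖ ^ 2 + ε m ^ 2)) atTop
      (𝓝 (l ^ 2 * ‖z‖ ^ 2 / (‖y‖ ^ 2 + 0 ^ 2))) :=
    tendsto_const_nhds.div (tendsto_const_nhds.add (hε.pow 2)) (by positivity)
  have h2 : 1 ≤ l ^ 2 * ‖z‖ ^ 2 / (‖y‖ ^ 2 + 0 ^ 2) := by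
    rw [one_le_div (by positivity), ← mul_pow]
    simpa using pow_le_pow_left₀ hy0.le h 2
  have h3 := ((Real.smoothTransition.continuous.tendsto _).comp h1).smul_const y
  rwa [Real.smoothTransition.one_of_one_le h2, one_smul] at h3

/-- A map of `W^{1,2}(Ω)` that is dominated pointwise by a map of `W_0^{1,2}(Ω)` belongs to
`W_0^{1,2}(Ω)`. -/
theorem MemW012.of_norm_le {f φ : Rn n → Rn 3} {g : Fin n → Rn n → Rn 3} (hΩ : IsOpen Ω)
    (hf : HasL2WeakGradient Ω f g) (hφ : MemW012 Ω φ) {l : ℝ} (hl : 0 ≤ l)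
    (hle : ∀ᵐ x ∂volume.restrict Ω, ‖f x‖ ≤ l * ‖φ x‖) : MemW012 Ω f := by
  obtain ⟨gφ, hgφ, hφa⟩ := hφ
  obtain ⟨M, hM0, hM⟩ := exists_norm_fderiv_smoothTruncation_le hl
  set μ := volume.restrict Ω with hμ
  set ε : ℕ → ℝ := fun m => 1 / ((m : ℝ) + 1) with hε
  have hεpos m : 0 < ε m := by positivity
  have hεlim : Tendsto ε atTop (𝓝 0) := tendsto_one_div_add_atTop_nhds_zero_nat
  have hE m : 0 < ENNReal.ofReal (ε m) := ENNReal.ofReal_pos.2 (hεpos m)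
  have hE1 m : ENNReal.ofReal (ε m) ≤ 1 := by
    rw [ENNReal.ofReal_le_one, hε]
    exact (div_le_one (by positivity)).2 (by simp)
  choose ψ hψ hψ0 hψ1 using fun m => hφa _ (hE m)
  have hap : ∀ m, ∃ F : Rn n → Rn 3, ContDiff ℝ ∞ F ∧
      eLpNorm (F - f) 2 (volume.restrict (tsupport (ψ m))) ≤ ENNReal.ofReal (ε m) ∧
      ∀ i, eLpNorm (partialDeriv i F - g i) 2 (volume.restrict (tsupport (ψ m))) ≤
        ENNReal.ofReal (ε m) := fun m => by
    obtain ⟨F, h1, h2, h3⟩ := hf.exists_contDiff_tendsto hΩ (hψ m).2.1 (hψ m).2.2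
    obtain ⟨j, hj⟩ := ((ENNReal.tendsto_nhds_zero.1 h2 _ (hE m)).and
      (eventually_all.2 fun i => ENNReal.tendsto_nhds_zero.1 (h3 i) _ (hE m))).exists
    exact ⟨F j, h1 j, hj.1, hj.2⟩
  choose F hF hF0 hF1 using hap
  -- `F m` truncated at height `≈ l ‖ψ m‖` is a test function; compare it with the truncation of `f`
  -- by `ψ m` (`A m`) and by `φ` (`B m`)
  set T : ℕ → Rn n → Rn 3 := fun m x => smoothTruncation l (ε m) (F m x, ψ m x) with hT
  have hT0 m x (hx : x ∉ tsupport (ψ m)) : T m x = 0 := by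
    simp only [hT, image_eq_zero_of_notMem_tsupport hx, smoothTruncation_zero_right]
  have hTs m : tsupport (T m) ⊆ tsupport (ψ m) :=
    closure_minimal (fun x hx => by
      by_contra h
      exact hx (hT0 m x h)) (isClosed_tsupport _)
  have hTt m : IsTestFunction Ω (T m) :=
    ⟨(contDiff_smoothTruncation l (hεpos m)).comp ((hF m).prodMk (hψ m).1),
      (hψ m).2.1.of_isClosed_subset (isClosed_tsupport _) (hTs m), (hTs m).trans (hψ m).2.2⟩
  have hKm m : MeasurableSet (tsupport (ψ m)) := (isClosed_tsupport _).measurableSet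
  have hKΩ m : volume.restrict (tsupport (ψ m)) ≤ μ := Measure.restrict_mono_set _ (hψ m).2.2
  -- functions that vanish off the support of `ψ m` have the same norm on `Ω` and on that support
  have hres m (k : Rn n → Rn 3) (hk : ∀ x, x ∉ tsupport (ψ m) → k x = 0) :
      eLpNorm k 2 μ = eLpNorm k 2 (volume.restrict (tsupport (ψ m))) := by
    have e1 : (tsupport (ψ m)).indicator k = k := indicator_eq_self.2 fun x hx => by
      by_contra h
      exact hx (hk x h)
    conv_lhs => rw [← e1]
    rw [eLpNorm_indicator_eq_eLpNorm_restrict (hKm m), hμ,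
      Measure.restrict_restrict_of_subset (hψ m).2.2]
  have hψμ m : eLpNorm (ψ m - φ) 2 μ ≤ ENNReal.ofReal (ε m) := by
    rw [eLpNorm_sub_comm]; exact (hψ0 m).le
  have hψm m : AEStronglyMeasurable (ψ m) μ := (hψ m).1.continuous.aestronglyMeasurable
  have hTm m : AEStronglyMeasurable (T m) μ := (hTt m).1.continuous.aestronglyMeasurable
  have hlip m := norm_smoothTruncation_sub_le hM0 (hεpos m) (hM (ε m) (hεpos m))
  have hcm m {a b : Rn n → Rn 3} (ha : AEStronglyMeasurable a μ)
      (hb : AEStronglyMeasurable b μ) :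
      AEStronglyMeasurable (fun x => smoothTruncation l (ε m) (a x, b x)) μ :=
    (contDiff_smoothTruncation l (hεpos m)).continuous.comp_aestronglyMeasurable (ha.prodMk hb)
  set c := ENNReal.ofReal (2 * M) with hc
  set A : ℕ → Rn n → Rn 3 := fun m x => smoothTruncation l (ε m) (f x, ψ m x) with hA
  set B : ℕ → Rn n → Rn 3 := fun m x => smoothTruncation l (ε m) (f x, φ x) with hB
  have hAm m : AEStronglyMeasurable (A m) μ := hcm m hf.1.1 (hψm m)
  have hBm m : AEStronglyMeasurable (B m) μ := hcm m hf.1.1 hgφ.1.1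
  have h1 m : eLpNorm (T m - A m) 2 μ ≤ c * ENNReal.ofReal (ε m) := by
    rw [hres m _ fun x hx => by
      simp only [Pi.sub_apply, hT0 m x hx, hA, image_eq_zero_of_notMem_tsupport hx,
        smoothTruncation_zero_right, sub_zero]]
    refine (eLpNorm_le_mul_eLpNorm_of_ae_le_mul (.of_forall fun x => ?_) 2).trans
      (mul_le_mul' le_rfl (hF0 m))
    simpa using hlip m (F m x, ψ m x) (f x, ψ m x)
  have h2 m : eLpNorm (A m - B m) 2 μ ≤ c * ENNReal.ofReal (ε m) := by
    refine (eLpNorm_le_mul_eLpNorm_of_ae_le_mul (.of_forall fun x => ?_) 2).trans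
      (mul_le_mul' le_rfl (hψμ m))
    simpa using hlip m (f x, ψ m x) (f x, φ x)
  have h3 : Tendsto (fun m => eLpNorm (B m - f) 2 μ) atTop (𝓝 0) := by
    have h4 : Tendsto (fun m => ∫⁻ x, ‖(B m - f) x‖ₑ ^ 2 ∂μ) atTop (𝓝 (∫⁻ _, 0 ∂μ)) := by
      refine tendsto_lintegral_of_dominated_convergence' (fun x => (2 * ‖f x‖ₑ) ^ 2)
        (fun m => ((hBm m).sub hf.1.1).enorm.pow_const 2) (fun m => .of_forall fun x => ?_) ?_ ?_
      · refine pow_le_pow_left' (enorm_sub_le.trans ?_) 2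
        rw [two_mul]
        exact add_le_add (enorm_le_iff_norm_le.2 (norm_smoothTruncation_le _ _ _)) le_rfl
      · simp only [mul_pow]
        rw [lintegral_const_mul' _ _ (by norm_num), ← eLpNorm_two_sq]
        exact ENNReal.mul_ne_top (by norm_num) (ENNReal.pow_ne_top hf.1.2.ne)
      · filter_upwards [hle] with x hx
        have h5 := (tendsto_smoothTruncation hx hεlim).sub_const (f x)
        rw [sub_self] at h5
        have h6 := (ENNReal.continuous_pow 2).tendsto _ |>.comp
          ((continuous_enorm.tendsto _).comp h5)
        simpa [Function.comp_def] using h6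
    simp only [← eLpNorm_two_sq, lintegral_zero] at h4
    have h5 := (ENNReal.continuous_rpow_const (y := (1 / 2 : ℝ))).tendsto _ |>.comp h4
    rw [ENNReal.zero_rpow_of_pos (by norm_num)] at h5
    refine h5.congr fun m => ?_
    simp only [Function.comp]
    rw [← ENNReal.rpow_natCast, ← ENNReal.rpow_mul]
    norm_num
  have hlim : Tendsto (fun m => eLpNorm (T m - f) 2 μ) atTop (𝓝 0) := by
    have hc0 : Tendsto (fun m => c * ENNReal.ofReal (ε m)) atTop (𝓝 0) := by
      have := ENNReal.Tendsto.const_mul (a := c) (ENNReal.tendsto_ofReal hεlim)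
        (.inr ENNReal.ofReal_ne_top)
      simpa using this
    have h4 := (hc0.add hc0).add h3
    simp only [add_zero] at h4
    refine tendsto_of_tendsto_of_tendsto_of_le_of_le tendsto_const_nhds h4
      (fun _ => zero_le) fun m => ?_
    have e : T m - f = (T m - A m) + (A m - B m) + (B m - f) := by abel
    rw [e]
    refine (eLpNorm_add_le (((hTm m).sub (hAm m)).add ((hAm m).sub (hBm m)))
      ((hBm m).sub hf.1.1) (by norm_num)).trans (add_le_add ?_ le_rfl)
    exact (eLpNorm_add_le ((hTm m).sub (hAm m)) ((hAm m).sub (hBm m)) (by norm_num)).trans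
      (add_le_add (h1 m) (h2 m))
  have happ {ν : Measure (Rn n)} {a b : Rn n → Rn 3} (ha : AEStronglyMeasurable a ν)
      (hb : AEStronglyMeasurable b ν) {e : ℝ≥0∞} (he : e ≤ 1) (hab : eLpNorm (a - b) 2 ν ≤ e) :
      eLpNorm a 2 ν ≤ eLpNorm b 2 ν + 1 := by
    have h := eLpNorm_add_le hb (ha.sub hb) (p := 2) (by norm_num)
    rw [add_sub_cancel] at h
    exact h.trans (add_le_add le_rfl (hab.trans he))
  set G := ∑ i, eLpNorm (g i) 2 μ
  set Gφ := ∑ i, eLpNorm (gφ i) 2 μ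
  set N : ℝ≥0∞ := (eLpNorm f 2 μ + 1) + ENNReal.ofReal M * ((G + 1) + (Gφ + 1))
  have hG : G ≠ ⊤ := ENNReal.sum_ne_top.2 fun i _ => (hf.2.1 i).2.ne
  have hGφ : Gφ ≠ ⊤ := ENNReal.sum_ne_top.2 fun i _ => (hgφ.2.1 i).2.ne
  refine memW012_of_bounded_of_tendsto hΩ hf hTt hlim (M := N) ?_ (fun m => ?_) fun m i => ?_
  · exact ENNReal.add_ne_top.2 ⟨ENNReal.add_ne_top.2 ⟨hf.1.2.ne, by simp⟩,
      ENNReal.mul_ne_top ENNReal.ofReal_ne_top (by simp [hG, hGφ])⟩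
  · refine le_trans ?_ le_self_add
    rw [hres m _ (hT0 m)]
    calc eLpNorm (T m) 2 (volume.restrict (tsupport (ψ m)))
        ≤ eLpNorm (F m) 2 (volume.restrict (tsupport (ψ m))) :=
          eLpNorm_mono fun x => norm_smoothTruncation_le _ _ _
      _ ≤ eLpNorm f 2 (volume.restrict (tsupport (ψ m))) + 1 :=
          happ (hF m).continuous.aestronglyMeasurable (hf.1.1.mono_measure (hKΩ m)) (hE1 m) (hF0 m)
      _ ≤ _ := by gcongr; exact hKΩ m
  · refine le_trans ?_ le_add_self
    rw [hres m _ fun x hx => partialDeriv_eq_zero_of_notMem_tsupport (fun h => hx (hTs m h)) i]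
    have hd x : ‖partialDeriv i (T m) x‖ ≤
        M * ‖‖partialDeriv i (F m) x‖ + ‖partialDeriv i (ψ m) x‖‖ := by
      rw [Real.norm_of_nonneg (by positivity)]
      have h4 := (((contDiff_smoothTruncation l (hεpos m)).differentiable (by simp)
        (F m x, ψ m x)).hasFDerivAt.comp x (((hF m).differentiable (by simp) x).hasFDerivAt.prodMk
          ((hψ m).1.differentiable (by simp) x).hasFDerivAt)).fderiv
      have h5 : partialDeriv i (T m) x = fderiv ℝ (smoothTruncation l (ε m)) (F m x, ψ m x)
          (partialDeriv i (F m) x, partialDeriv i (ψ m) x) :=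
        congrArg (fun L => L (EuclideanSpace.single i 1)) h4
      rw [h5]
      exact hM (ε m) (hεpos m) _ _
    refine (eLpNorm_le_mul_eLpNorm_of_ae_le_mul (.of_forall hd) 2).trans (mul_le_mul' le_rfl ?_)
    have hFm := (continuous_partialDeriv (hF m) i).aestronglyMeasurable
      (μ := volume.restrict (tsupport (ψ m)))
    have hψm' := (continuous_partialDeriv (hψ m).1 i).aestronglyMeasurable
      (μ := volume.restrict (tsupport (ψ m)))
    have h6 := eLpNorm_add_le hFm.norm hψm'.norm (p := 2) (by norm_num)
    rw [eLpNorm_norm, eLpNorm_norm] at h6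
    refine h6.trans (add_le_add ?_ ?_)
    · refine (happ hFm ((hf.2.1 i).1.mono_measure (hKΩ m)) (hE1 m) (hF1 m i)).trans ?_
      gcongr
      exact (eLpNorm_mono_measure _ (hKΩ m)).trans
        (Finset.single_le_sum (f := fun i => eLpNorm (g i) 2 μ) (fun _ _ => zero_le)
          (Finset.mem_univ i))
    · refine (happ hψm' ((hgφ.2.1 i).1.mono_measure (hKΩ m)) (hE1 m) ?_).trans ?_
      · rw [eLpNorm_sub_comm]
        exact (eLpNorm_mono_measure _ (hKΩ m)).trans (hψ1 m i).le
      · gcongr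
        exact (eLpNorm_mono_measure _ (hKΩ m)).trans
          (Finset.single_le_sum (f := fun i => eLpNorm (gφ i) 2 μ) (fun _ _ => zero_le)
            (Finset.mem_univ i))

end Domination

/-! ### Cutoffs -/

section Cutoff

/-- Smooth cutoffs that vanish on `B_ε(c)` and equal `1` off `B_{2ε}(c)`, with gradient of order
`1 / ε`. -/
theorem exists_contDiff_cutoff (m : ℕ) : ∃ B : ℝ, 0 ≤ B ∧ ∀ (c : Rn m) (ε : ℝ), 0 < ε →
    ∃ η : Rn m → ℝ, ContDiff ℝ ∞ η ∧ (∀ y, ‖y - c‖ ≤ ε → η y = 0) ∧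
      (∀ y, 2 * ε ≤ ‖y - c‖ → η y = 1) ∧ (∀ y, 0 ≤ η y) ∧ (∀ y, η y ≤ 1) ∧
      ∀ y, ‖fderiv ℝ η y‖ ≤ B / ε := by
  let b : ContDiffBump (0 : Rn m) := ⟨1, 2, one_pos, one_lt_two⟩
  have hb : ContDiff ℝ ∞ b := b.contDiff
  obtain ⟨B, hB⟩ := (b.hasCompactSupport.fderiv ℝ).exists_bound_of_continuous
    (hb.continuous_fderiv (by simp))
  have hB0 : 0 ≤ B := (norm_nonneg _).trans (hB 0)
  refine ⟨B, hB0, fun c ε hε => ?_⟩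
  have hn (y : Rn m) : ‖ε⁻¹ • (y - c)‖ = ‖y - c‖ / ε := by
    rw [norm_smul, norm_inv, Real.norm_of_nonneg hε.le, inv_mul_eq_div]
  refine ⟨fun y => 1 - b (ε⁻¹ • (y - c)), contDiff_const.sub (hb.comp
    ((contDiff_id.sub contDiff_const).const_smul ε⁻¹)), fun y hy => ?_, fun y hy => ?_,
    fun y => sub_nonneg.2 b.le_one, fun y => sub_le_self _ b.nonneg, fun y => ?_⟩
  · change 1 - b (ε⁻¹ • (y - c)) = 0
    rw [b.one_of_mem_closedBall, sub_self]
    rw [mem_closedBall_zero_iff, hn]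
    exact (div_le_one hε).2 hy
  · change 1 - b (ε⁻¹ • (y - c)) = 1
    rw [b.zero_of_le_dist, sub_zero]
    rw [dist_zero_right, hn]
    exact (le_div_iff₀ hε).2 hy
  · have h1 : HasFDerivAt (fun x : Rn m => ε⁻¹ • (x - c))
        (ε⁻¹ • ContinuousLinearMap.id ℝ (Rn m)) y :=
      ((hasFDerivAt_id y).sub_const c).fun_const_smul ε⁻¹
    have h2 := (((hb.differentiable (by simp) (ε⁻¹ • (y - c))).hasFDerivAt).comp y h1).const_sub 1
    refine (congrArg norm h2.fderiv).trans_le ?_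
    rw [norm_neg]
    refine (ContinuousLinearMap.opNorm_comp_le _ _).trans ?_
    rw [div_eq_mul_inv]
    refine mul_le_mul (hB _) ?_ (norm_nonneg _) hB0
    rw [norm_smul, norm_inv, Real.norm_of_nonneg hε.le]
    exact mul_le_of_le_one_right (by positivity) ContinuousLinearMap.norm_id_le

end Cutoff

/-! ### Projection onto the sphere from an interior point -/

section RaySphere

open Filter Topology
open scoped RealInnerProductSpace

/-- The vector from `a` to the point where the ray from `a` in the direction `z` meets the unit
sphere, as a function of the pair `p = (a, z)`. The scalar is the positive root `t` of
`‖a + t z‖² = 1`. -/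
noncomputable def raySphereVec (p : Rn 3 × Rn 3) : Rn 3 :=
  ((-⟪p.1, p.2⟫ + √(⟪p.1, p.2⟫ ^ 2 + (1 - ‖p.1‖ ^ 2) * ‖p.2‖ ^ 2)) / ‖p.2‖ ^ 2) • p.2

/-- The point where the ray from `a` through `y` meets the unit sphere; the value at `y = a` is
`a`. -/
noncomputable def raySphere (a y : Rn 3) : Rn 3 := a + raySphereVec (a, y - a)

theorem norm_raySphere {a y : Rn 3} (ha : ‖a‖ < 1) (hy : y ≠ a) : ‖raySphere a y‖ = 1 := by
  set z := y - a with hz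
  have hz0 : 0 < ‖z‖ := norm_pos_iff.2 (sub_ne_zero.2 hy)
  have ha2 : ‖a‖ ^ 2 < 1 := by nlinarith [norm_nonneg a]
  set D := ⟪a, z⟫ ^ 2 + (1 - ‖a‖ ^ 2) * ‖z‖ ^ 2 with hD
  have hD0 : 0 ≤ D := by
    have := mul_nonneg (sub_nonneg.2 ha2.le) (sq_nonneg ‖z‖)
    positivity
  have hs := Real.sq_sqrt hD0
  set t := (-⟪a, z⟫ + √D) / ‖z‖ ^ 2 with ht
  have ht' : t * ‖z‖ ^ 2 = -⟪a, z⟫ + √D := by rw [ht]; field_simp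
  have h1 : ‖raySphere a y‖ ^ 2 = 1 := by
    change ‖a + t • z‖ ^ 2 = 1
    rw [norm_add_sq_real, inner_smul_right, norm_smul, mul_pow, Real.norm_eq_abs, sq_abs]
    have h2 : t ^ 2 * ‖z‖ ^ 2 * ‖z‖ ^ 2 = (-⟪a, z⟫ + √D) ^ 2 := by rw [← ht']; ring
    have h3 : (‖a‖ ^ 2 + 2 * (t * ⟪a, z⟫) + t ^ 2 * ‖z‖ ^ 2) * ‖z‖ ^ 2 = 1 * ‖z‖ ^ 2 := by
      linear_combination h2 + 2 * ⟪a, z⟫ * ht' + hs + hD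
    exact mul_right_cancel₀ (by positivity) h3
  exact (sq_eq_sq₀ (norm_nonneg _) zero_le_one).1 (by rw [h1, one_pow])

theorem raySphere_of_norm_eq_one {a y : Rn 3} (ha : ‖a‖ < 1) (hy : ‖y‖ = 1) :
    raySphere a y = y := by
  set z := y - a with hz
  have hya : y = a + z := by rw [hz]; abel
  have hz0 : 0 < ‖z‖ := norm_pos_iff.2 (sub_ne_zero.2 fun h => by rw [h] at hy; linarith)
  have h1 : ‖a‖ ^ 2 + 2 * ⟪a, z⟫ + ‖z‖ ^ 2 = 1 := by
    rw [← norm_add_sq_real, ← hya, hy, one_pow]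
  have h2 : 0 ≤ ⟪a, z⟫ + ‖z‖ ^ 2 := by
    have h3 : ⟪y, a⟫ ≤ ‖y‖ * ‖a‖ := real_inner_le_norm y a
    have h4 : ⟪a, z⟫ + ‖z‖ ^ 2 = 1 - ⟪y, a⟫ := by
      rw [← real_inner_self_eq_norm_sq, ← inner_add_left, ← hya, hz, inner_sub_right,
        real_inner_self_eq_norm_sq, hy, one_pow]
    rw [h4]
    rw [hy] at h3
    linarith
  have h3 : ⟪a, z⟫ ^ 2 + (1 - ‖a‖ ^ 2) * ‖z‖ ^ 2 = (⟪a, z⟫ + ‖z‖ ^ 2) ^ 2 := by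
    linear_combination (-‖z‖ ^ 2) * h1
  have h4 : (-⟪a, z⟫ + √(⟪a, z⟫ ^ 2 + (1 - ‖a‖ ^ 2) * ‖z‖ ^ 2)) / ‖z‖ ^ 2 = 1 := by
    rw [h3, Real.sqrt_sq h2]
    field_simp
    ring
  change a + ((-⟪a, z⟫ + √(⟪a, z⟫ ^ 2 + (1 - ‖a‖ ^ 2) * ‖z‖ ^ 2)) / ‖z‖ ^ 2) • z = y
  rw [h4, one_smul, ← hya]

/-- The projection depends only on the direction of the ray. -/
theorem raySphereVec_smul (a z : Rn 3) {c : ℝ} (hc : 0 < c) :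
    raySphereVec (a, c • z) = raySphereVec (a, z) := by
  by_cases hz : z = 0
  · simp [hz, raySphereVec]
  have hz0 : 0 < ‖z‖ := norm_pos_iff.2 hz
  simp only [raySphereVec, inner_smul_right, norm_smul, Real.norm_of_nonneg hc.le, smul_smul]
  have h1 : (c * ⟪a, z⟫) ^ 2 + (1 - ‖a‖ ^ 2) * (c * ‖z‖) ^ 2 =
      c ^ 2 * (⟪a, z⟫ ^ 2 + (1 - ‖a‖ ^ 2) * ‖z‖ ^ 2) := by ring
  rw [h1, Real.sqrt_mul (sq_nonneg c), Real.sqrt_sq hc.le]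
  congr 1
  field_simp

theorem contDiffAt_raySphereVec {p : Rn 3 × Rn 3} (ha : ‖p.1‖ < 1) (hz : p.2 ≠ 0) :
    ContDiffAt ℝ ∞ raySphereVec p := by
  have hz0 : 0 < ‖p.2‖ := norm_pos_iff.2 hz
  have ha2 : 0 < 1 - ‖p.1‖ ^ 2 := by nlinarith [norm_nonneg p.1]
  have hi : ContDiffAt ℝ ∞ (fun p : Rn 3 × Rn 3 => ⟪p.1, p.2⟫) p :=
    contDiffAt_fst.inner ℝ contDiffAt_snd
  have hn : ContDiffAt ℝ ∞ (fun p : Rn 3 × Rn 3 => ‖p.2‖ ^ 2) p := contDiffAt_snd.norm_sq ℝ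
  have hs : ContDiffAt ℝ ∞
      (fun p : Rn 3 × Rn 3 => √(⟪p.1, p.2⟫ ^ 2 + (1 - ‖p.1‖ ^ 2) * ‖p.2‖ ^ 2)) p :=
    ((hi.pow 2).add ((contDiffAt_const.sub (contDiffAt_fst.norm_sq ℝ)).mul hn)).sqrt
      (by positivity)
  exact ((hi.neg.add hs).div hn (by positivity)).smul contDiffAt_snd

/-- The radial projection from `a` is smooth off `a`, and its derivative at `y` is at most
`C / ‖y - a‖`, uniformly for `‖a‖ ≤ 1/2`. -/
theorem exists_norm_fderiv_raySphere_le : ∃ C : ℝ, 0 ≤ C ∧ ∀ a : Rn 3, ‖a‖ ≤ 1 / 2 →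
    ∀ y ≠ a, ‖fderiv ℝ (raySphere a) y‖ ≤ C / ‖y - a‖ := by
  -- by homogeneity it suffices to bound the derivative on a compact set of directions
  set S : Set (Rn 3 × Rn 3) := Metric.closedBall 0 (1 / 2) ×ˢ Metric.sphere 0 1 with hS
  have hSc : IsCompact S := (isCompact_closedBall _ _).prod (isCompact_sphere _ _)
  have hat : ∀ p ∈ S, ContDiffAt ℝ ∞ raySphereVec p := fun p hp => by
    have h1 : ‖p.1‖ ≤ 1 / 2 := by simpa using hp.1
    have h2 : ‖p.2‖ = 1 := by simpa using hp.2
    exact contDiffAt_raySphereVec (by linarith) (norm_ne_zero_iff.1 (by rw [h2]; norm_num))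
  have hcont : ContinuousOn (fderiv ℝ raySphereVec) S := fun p hp =>
    ((hat p hp).fderiv_right (m := 0) (by simp)).continuousAt.continuousWithinAt
  obtain ⟨C, hC⟩ := hSc.exists_bound_of_continuousOn hcont
  refine ⟨max C 0 * ‖ContinuousLinearMap.inr ℝ (Rn 3) (Rn 3)‖, by positivity,
    fun a ha y hy => ?_⟩
  set z := y - a with hz
  have hz0 : 0 < ‖z‖ := norm_pos_iff.2 (sub_ne_zero.2 hy)
  have hpair : HasFDerivAt (fun x : Rn 3 => (a, x)) (ContinuousLinearMap.inr ℝ (Rn 3) (Rn 3))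
      (‖z‖⁻¹ • z) := hasFDerivAt_prodMk_right a _
  have hmem : (a, ‖z‖⁻¹ • z) ∈ S := ⟨by simpa using ha, by
    rw [mem_sphere_zero_iff_norm, norm_smul, norm_inv, norm_norm, inv_mul_cancel₀ hz0.ne']⟩
  have h1 := (((hat _ hmem).differentiableAt (by simp)).hasFDerivAt).comp (‖z‖⁻¹ • z) hpair
  have h2 : HasFDerivAt (fun x : Rn 3 => ‖z‖⁻¹ • (x - a))
      (‖z‖⁻¹ • ContinuousLinearMap.id ℝ (Rn 3)) y :=
    ((hasFDerivAt_id y).sub_const a).fun_const_smul ‖z‖⁻¹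
  have h3 := (h1.comp y h2).const_add a
  have h4 : raySphere a = fun x => a + (raySphereVec ∘ fun x => (a, x)) (‖z‖⁻¹ • (x - a)) := by
    funext x
    simp only [Function.comp, raySphere, raySphereVec_smul a _ (inv_pos.2 hz0)]
  rw [h4]
  refine (congrArg norm h3.fderiv).trans_le ((ContinuousLinearMap.opNorm_comp_le _ _).trans ?_)
  rw [div_eq_mul_inv]
  refine mul_le_mul ((ContinuousLinearMap.opNorm_comp_le _ _).trans ?_) ?_ (norm_nonneg _)
    (by positivity)
  · gcongr
    exact (hC _ hmem).trans (le_max_left _ _)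
  · rw [norm_smul, norm_inv, norm_norm]
    exact mul_le_of_le_one_right (by positivity) ContinuousLinearMap.norm_id_le

theorem contDiffAt_raySphere {a y : Rn 3} (ha : ‖a‖ < 1) (hy : y ≠ a) :
    ContDiffAt ℝ ∞ (raySphere a) y := by
  have h : ContDiffAt ℝ ∞ (fun y : Rn 3 => (a, y - a)) y :=
    contDiffAt_const.prodMk (contDiffAt_id.sub contDiffAt_const)
  have h2 := contDiffAt_raySphereVec (p := (a, y - a)) ha (sub_ne_zero.2 hy)
  have h3 : ContDiffAt ℝ ∞ (raySphereVec ∘ fun y : Rn 3 => (a, y - a)) y := h2.comp y h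
  exact contDiffAt_const.add h3

/-- Smooth truncations of the radial projection near its singularity, with the same type of bound
on the derivative. -/
theorem exists_truncation_raySphere : ∃ C : ℝ, 0 ≤ C ∧ ∀ a : Rn 3, ‖a‖ ≤ 1 / 2 →
    (∀ y ≠ a, ‖fderiv ℝ (raySphere a) y‖ ≤ C / ‖y - a‖) ∧
    ∀ ε : ℝ, 0 < ε → ∃ Φ : Rn 3 → Rn 3, ContDiff ℝ 1 Φ ∧ (∀ y, ‖Φ y‖ ≤ 1) ∧
      (∃ C' : ℝ, ∀ y, ‖fderiv ℝ Φ y‖ ≤ C') ∧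
      (∀ y ≠ a, ‖fderiv ℝ Φ y‖ ≤ C / ‖y - a‖) ∧
      ∀ y, 2 * ε < ‖y - a‖ → Φ =ᶠ[𝓝 y] raySphere a := by
  obtain ⟨C, hC0, hC⟩ := exists_norm_fderiv_raySphere_le
  obtain ⟨B, hB0, hB⟩ := exists_contDiff_cutoff 3
  refine ⟨C + 2 * B, by positivity, fun a ha => ⟨fun y hy => (hC a ha y hy).trans ?_,
    fun ε hε => ?_⟩⟩
  · gcongr
    linarith
  have ha1 : ‖a‖ < 1 := by linarith
  obtain ⟨η, hηc, hη0, hη1, hηnn, hηle, hη'⟩ := hB a ε hε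
  have hη01 y : ‖η y‖ ≤ 1 := by
    rw [Real.norm_of_nonneg (hηnn y)]
    exact hηle y
  have hnear y (hy : ‖y - a‖ < ε) : (fun y => η y • raySphere a y) =ᶠ[𝓝 y] fun _ => 0 := by
    have : ∀ᶠ x in 𝓝 y, ‖x - a‖ < ε :=
      (by fun_prop : Continuous fun x : Rn 3 => ‖x - a‖).continuousAt.eventually_lt_const hy
    exact this.mono fun x hx => by simp [hη0 x hx.le]
  have hfar y (hy : 2 * ε < ‖y - a‖) :
      (fun y => η y • raySphere a y) =ᶠ[𝓝 y] raySphere a := by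
    have : ∀ᶠ x in 𝓝 y, 2 * ε < ‖x - a‖ :=
      (by fun_prop : Continuous fun x : Rn 3 => ‖x - a‖).continuousAt.eventually_const_lt hy
    exact this.mono fun x hx => by simp [hη1 x hx.le]
  have hbd y (hy : y ≠ a) :
      ‖fderiv ℝ (fun y => η y • raySphere a y) y‖ ≤ (C + 2 * B) / ‖y - a‖ := by
    have hya : 0 < ‖y - a‖ := norm_pos_iff.2 (sub_ne_zero.2 hy)
    by_cases h : 2 * ε < ‖y - a‖
    · rw [(hfar y h).fderiv_eq]
      refine (hC a ha y hy).trans ?_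
      gcongr
      linarith
    · rw [fderiv_fun_smul (hηc.differentiable (by simp) y)
        ((contDiffAt_raySphere ha1 hy).differentiableAt (by simp)), add_div]
      refine (norm_add_le _ _).trans (add_le_add ?_ ?_)
      · rw [norm_smul]
        exact (mul_le_mul (hη01 y) (hC a ha y hy) (norm_nonneg _) zero_le_one).trans_eq
          (one_mul _)
      · rw [ContinuousLinearMap.norm_smulRight_apply, norm_raySphere ha1 hy, mul_one]
        refine (hη' y).trans ?_
        rw [div_le_div_iff₀ hε hya]
        nlinarith
  refine ⟨fun y => η y • raySphere a y, contDiff_iff_contDiffAt.2 fun y => ?_, fun y => ?_,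
    ⟨(C + 2 * B) / ε, fun y => ?_⟩, hbd, hfar⟩
  · by_cases hy : y = a
    · exact contDiffAt_const.congr_of_eventuallyEq (hnear y (by simpa [hy] using hε))
    · exact (hηc.contDiffAt.smul (contDiffAt_raySphere ha1 hy)).of_le (by simp)
  · change ‖η y • raySphere a y‖ ≤ 1
    by_cases hy : y = a
    · rw [hη0 y (by simpa [hy] using hε.le), zero_smul, norm_zero]
      exact zero_le_one
    · rw [norm_smul, norm_raySphere ha1 hy, mul_one]
      exact hη01 y
  · by_cases h : ‖y - a‖ < ε
    · rw [(hnear y h).fderiv_eq]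
      simp only [fderiv_fun_const, Pi.zero_apply, norm_zero]
      positivity
    · have hy : y ≠ a := fun hya => h (by simpa [hya] using hε)
      refine (hbd y hy).trans ?_
      gcongr
      exact not_lt.1 h

end RaySphere

/-! ### Projections of Sobolev maps to the sphere -/

section Projection

open Filter Topology

/-- The radial projection is Lipschitz at the points of the sphere: near the sphere its derivative
is bounded, and far from it the projection moves points by a bounded amount. -/
theorem exists_norm_raySphere_sub_le : ∃ L : ℝ, 0 ≤ L ∧ ∀ a : Rn 3, ‖a‖ ≤ 1 / 2 → ∀ y w : Rn 3,
    ‖y‖ = 1 → w ≠ a → ‖raySphere a w - y‖ ≤ L * ‖w - y‖ := by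
  obtain ⟨C, hC0, hC⟩ := exists_norm_fderiv_raySphere_le
  refine ⟨4 * C + 8, by positivity, fun a ha y w hy hw => ?_⟩
  have ha1 : ‖a‖ < 1 := by linarith
  by_cases h : ‖w - y‖ < 1 / 4
  · have hfar : ∀ x ∈ Metric.ball y (1 / 4), 1 / 4 ≤ ‖x - a‖ := fun x hx => by
      rw [mem_ball_iff_norm] at hx
      have h1 : ‖y‖ ≤ ‖x - a‖ + ‖a‖ + ‖x - y‖ := by
        have : y = (x - a) + a - (x - y) := by abel
        calc ‖y‖ = ‖(x - a) + a - (x - y)‖ := congrArg norm this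
          _ ≤ _ := (norm_sub_le _ _).trans (add_le_add (norm_add_le _ _) le_rfl)
      linarith
    have hne : ∀ x ∈ Metric.ball y (1 / 4), x ≠ a := fun x hx hxa => by
      have := hfar x hx
      rw [hxa, sub_self, norm_zero] at this
      linarith
    have h2 := (convex_ball y (1 / 4)).norm_image_sub_le_of_norm_fderiv_le (f := raySphere a)
      (C := 4 * C) (𝕜 := ℝ)
      (fun x hx => (contDiffAt_raySphere ha1 (hne x hx)).differentiableAt (by simp))
      (fun x hx => (hC a ha x (hne x hx)).trans (by
        have := hfar x hx
        rw [div_le_iff₀ (by linarith)]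
        nlinarith)) (Metric.mem_ball_self (by norm_num)) (mem_ball_iff_norm.2 h)
    rw [raySphere_of_norm_eq_one ha1 hy] at h2
    refine h2.trans ?_
    gcongr
    linarith
  · have h1 := norm_sub_le (raySphere a w) y
    rw [norm_raySphere ha1 hw, hy] at h1
    have h2 : 1 / 4 ≤ ‖w - y‖ := not_lt.1 h
    nlinarith [norm_nonneg (w - y)]

/-- Chain rule for the radial projection from a point whose distance to the map is controlled. -/
theorem exists_hasL2WeakGradient_raySphere_comp : ∃ C : ℝ, 0 ≤ C ∧
    ∀ {n : ℕ} {Ω : Set (Rn n)} {w : Rn n → Rn 3} {g : Fin n → Rn n → Rn 3} {a : Rn 3},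
      IsOpen Ω → volume Ω ≠ ⊤ → HasL2WeakGradient Ω w g → ‖a‖ ≤ 1 / 2 →
      (∀ᵐ x ∂volume.restrict Ω, w x ≠ a) →
      (∀ i, MemLp (fun x => ‖w x - a‖⁻¹ * ‖g i x‖) 2 (volume.restrict Ω)) →
      ∃ h : Fin n → Rn n → Rn 3, HasL2WeakGradient Ω (fun x => raySphere a (w x)) h ∧
        ∀ i, ∀ᵐ x ∂volume.restrict Ω, ‖h i x‖ ≤ C * (‖w x - a‖⁻¹ * ‖g i x‖) := by
  obtain ⟨C, hC0, hC⟩ := exists_truncation_raySphere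
  refine ⟨C, hC0, fun {n Ω w g a} hΩ hvol hw ha hne hint => ?_⟩
  obtain ⟨hb, hΦ⟩ := hC a ha
  have ha1 : ‖a‖ < 1 := by linarith
  set ε : ℕ → ℝ := fun m => 1 / ((m : ℝ) + 1) with hε
  have hεpos m : 0 < ε m := by positivity
  have hεlim : Tendsto ε atTop (𝓝 0) := tendsto_one_div_add_atTop_nhds_zero_nat
  choose Φ hΦc hΦ1 hΦb hΦC hΦe using fun m => hΦ (ε m) (hεpos m)
  have hfin : IsFiniteMeasure (volume.restrict Ω) := isFiniteMeasure_restrict.2 hvol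
  have hev : ∀ᵐ x ∂volume.restrict Ω, ∀ᶠ m in atTop, Φ m =ᶠ[𝓝 (w x)] raySphere a := by
    filter_upwards [hne] with x hx
    have h1 : 0 < ‖w x - a‖ := norm_pos_iff.2 (sub_ne_zero.2 hx)
    have h2 := hεlim.const_mul 2
    rw [mul_zero] at h2
    exact (h2.eventually_lt_const h1).mono fun m hm => hΦe m _ hm
  have hle m i : ∀ᵐ x ∂volume.restrict Ω,
      ‖fderiv ℝ (Φ m) (w x) (g i x)‖ ≤ C * (‖w x - a‖⁻¹ * ‖g i x‖) := by
    filter_upwards [hne] with x hx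
    rw [← mul_assoc, ← div_eq_mul_inv]
    exact (fderiv ℝ (Φ m) (w x)).le_of_opNorm_le (hΦC m _ hx) _
  choose C' hC' using hΦb
  have hwk m := hw.comp_contDiff hΩ (hΦc m) (hΦ1 m) (hC' m)
  have hci i : MemLp (fun x => C * (‖w x - a‖⁻¹ * ‖g i x‖)) 2 (volume.restrict Ω) :=
    (hint i).const_mul C
  have hlim : ∀ᵐ x ∂volume.restrict Ω,
      Tendsto (fun m => Φ m (w x)) atTop (𝓝 (raySphere a (w x))) := by
    filter_upwards [hev] with x hx
    exact tendsto_const_nhds.congr' (hx.mono fun m hm => hm.self_of_nhds.symm)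
  have hglim i : ∀ᵐ x ∂volume.restrict Ω, Tendsto (fun m => fderiv ℝ (Φ m) (w x) (g i x)) atTop
      (𝓝 (fderiv ℝ (raySphere a) (w x) (g i x))) := by
    filter_upwards [hev] with x hx
    exact tendsto_const_nhds.congr' (hx.mono fun m hm => by simp only [hm.fderiv_eq])
  have key := hasWeakGradient_of_dominated_limit hwk
    (b := fun _ => 1) ((locallyIntegrable_const 1).locallyIntegrableOn Ω)
    (fun i => (hci i).locallyIntegrableOn_of_restrict) (fun m => .of_forall fun x => hΦ1 m _)
    hle hlim hglim
  have hle' i : ∀ᵐ x ∂volume.restrict Ω,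
      ‖fderiv ℝ (raySphere a) (w x) (g i x)‖ ≤ C * (‖w x - a‖⁻¹ * ‖g i x‖) := by
    filter_upwards [hne] with x hx
    rw [← mul_assoc, ← div_eq_mul_inv]
    exact (fderiv ℝ (raySphere a) (w x)).le_of_opNorm_le (hb _ hx) _
  refine ⟨_, ⟨?_, fun i => ?_, key⟩, hle'⟩
  · refine MemLp.of_bound key.1.aestronglyMeasurable 1 ?_
    filter_upwards [hne] with x hx
    exact (norm_raySphere ha1 hx).le
  · refine (hci i).mono (key.2.1 i).aestronglyMeasurable ?_
    filter_upwards [hle' i] with x hx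
    exact hx.trans (le_abs_self _)

/-- In `ℝ³` the function `‖z‖⁻²` is locally integrable, uniformly under translations. -/
theorem exists_lintegral_inv_enorm_sub_sq_le : ∃ C : ℝ≥0∞, C ≠ ⊤ ∧ ∀ p : Rn 3,
    ∫⁻ a in Metric.closedBall (0 : Rn 3) (1 / 2), (‖p - a‖ₑ ^ 2)⁻¹ ≤ C := by
  set B : Set (Rn 3) := Metric.closedBall 0 (1 / 2)
  have h1 : IntegrableOn (fun x : Rn 3 => (fun r : ℝ => (r ^ 2)⁻¹) ‖x‖) (Metric.ball 0 1) := by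
    rw [integrableOn_fun_norm_addHaar (μ := volume) (f := fun r : ℝ => (r ^ 2)⁻¹)]
    have h2 : IntegrableOn (fun _ : ℝ => (1 : ℝ)) (Ioo 0 1) := by
      simp
    refine h2.congr_fun (fun r hr => ?_) measurableSet_Ioo
    have : r ≠ 0 := hr.1.ne'
    -- the radial weight `r²` of `ℝ³` cancels the singularity
    simp [this]
  have h2 : ∫⁻ z in Metric.ball (0 : Rn 3) 1, (‖z‖ₑ ^ 2)⁻¹ ≠ ⊤ := by
    refine ne_of_eq_of_ne (lintegral_congr_ae ?_) h1.2.ne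
    have : ∀ᵐ z ∂(volume.restrict (Metric.ball (0 : Rn 3) 1)), z ≠ 0 :=
      ae_restrict_of_ae (Measure.ae_ne volume 0)
    filter_upwards [this] with z hz
    rw [Real.enorm_of_nonneg (by positivity), ENNReal.ofReal_inv_of_pos (by positivity),
      ENNReal.ofReal_pow (norm_nonneg _), ofReal_norm]
  refine ⟨_, ENNReal.add_ne_top.2 ⟨h2, (measure_closedBall_lt_top (μ := volume)
    (x := (0 : Rn 3)) (r := 1 / 2)).ne⟩, fun p => ?_⟩
  calc ∫⁻ a in B, (‖p - a‖ₑ ^ 2)⁻¹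
      ≤ ∫⁻ a in B, ((Metric.ball (0 : Rn 3) 1).indicator (fun z => (‖z‖ₑ ^ 2)⁻¹) (p - a) + 1) := by
        refine lintegral_mono fun a => ?_
        by_cases h : p - a ∈ Metric.ball (0 : Rn 3) 1
        · rw [indicator_of_mem h]
          exact le_self_add
        · refine le_trans ?_ le_add_self
          rw [ENNReal.inv_le_one]
          refine one_le_pow₀ ?_
          rw [← ofReal_norm, ENNReal.one_le_ofReal]
          simpa using h
    _ = (∫⁻ a in B, (Metric.ball (0 : Rn 3) 1).indicator (fun z => (‖z‖ₑ ^ 2)⁻¹) (p - a)) +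
          volume B := by
        rw [lintegral_add_right _ measurable_const]
        simp
    _ ≤ (∫⁻ a, (Metric.ball (0 : Rn 3) 1).indicator (fun z => (‖z‖ₑ ^ 2)⁻¹) (p - a)) +
          volume B := by
        gcongr
        exact Measure.restrict_le_self
    _ = _ := by
        rw [lintegral_sub_left_eq_self
          ((Metric.ball (0 : Rn 3) 1).indicator fun z => (‖z‖ₑ ^ 2)⁻¹),
          lintegral_indicator Metric.isOpen_ball.measurableSet]

/-- Among the points `a` of the ball of radius `1/2`, one is not too close to the values of `w`,
on average with respect to a given density `G`. -/
theorem exists_lintegral_mul_inv_enorm_sub_sq_le : ∃ C : ℝ≥0∞, C ≠ ⊤ ∧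
    ∀ {α : Type} [MeasurableSpace α] (μ : Measure α) [SFinite μ] {w : α → Rn 3} {G : α → ℝ≥0∞},
      AEMeasurable w μ → AEMeasurable G μ → ∃ a : Rn 3, ‖a‖ ≤ 1 / 2 ∧
        ∫⁻ x, G x * (‖w x - a‖ₑ ^ 2)⁻¹ ∂μ ≤ C * ∫⁻ x, G x ∂μ := by
  obtain ⟨C, hC, h⟩ := exists_lintegral_inv_enorm_sub_sq_le
  set B : Set (Rn 3) := Metric.closedBall 0 (1 / 2) with hB
  have hB0 : volume B ≠ 0 :=
    (Metric.measure_closedBall_pos volume (0 : Rn 3) (by norm_num)).ne'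
  have hBt : volume B ≠ ⊤ := measure_closedBall_lt_top.ne
  refine ⟨(volume B)⁻¹ * C, ENNReal.mul_ne_top (ENNReal.inv_ne_top.2 hB0) hC,
    fun μ _ w G hw hG => ?_⟩
  have hm : AEMeasurable (fun p : Rn 3 × _ => G p.2 * (‖w p.2 - p.1‖ₑ ^ 2)⁻¹)
      ((volume.restrict B).prod μ) :=
    hG.comp_snd.mul ((hw.comp_snd.sub measurable_fst.aemeasurable).enorm.pow_const 2).inv
  obtain ⟨a, ha, hle⟩ := exists_le_setLAverage hB0 hBt
    (f := fun a => ∫⁻ x, G x * (‖w x - a‖ₑ ^ 2)⁻¹ ∂μ) hm.lintegral_prod_right'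
  refine ⟨a, by simpa [hB] using ha, hle.trans ?_⟩
  rw [setLAverage_eq, ENNReal.div_eq_inv_mul, mul_assoc]
  gcongr
  rw [lintegral_lintegral_swap hm]
  calc ∫⁻ x, (∫⁻ a in B, G x * (‖w x - a‖ₑ ^ 2)⁻¹) ∂μ
      ≤ ∫⁻ x, G x * C ∂μ := by
        refine lintegral_mono fun x => ?_
        rw [lintegral_const_mul'' _ (by fun_prop)]
        gcongr
        exact h _
    _ = C * ∫⁻ x, G x ∂μ := by rw [lintegral_mul_const' _ _ hC, mul_comm]

end Projection

/-! ### Comparison maps -/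

section Comparison

open Filter Topology

/-- A map that takes values in the sphere off `A` can be projected to the sphere, at the cost of a
constant factor in the energy on `A`. -/
theorem exists_raySphere_comp_energy_le : ∃ C : ℝ≥0∞, C ≠ ⊤ ∧
    ∀ {n : ℕ} {Ω A : Set (Rn n)} {w : Rn n → Rn 3} {g : Fin n → Rn n → Rn 3},
      IsOpen Ω → volume Ω ≠ ⊤ → MeasurableSet A → HasL2WeakGradient Ω w g →
      (∀ᵐ x ∂volume.restrict Ω, x ∉ A → ‖w x‖ = 1) →
      ∃ a : Rn 3, ‖a‖ ≤ 1 / 2 ∧ (∀ᵐ x ∂volume.restrict Ω, w x ≠ a) ∧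
        ∃ h : Fin n → Rn n → Rn 3, HasL2WeakGradient Ω (fun x => raySphere a (w x)) h ∧
          ∫⁻ x in Ω ∩ A, ∑ i, ‖h i x‖ₑ ^ 2 ≤ C * ∫⁻ x in Ω ∩ A, (∑ i, ‖g i x‖ₑ ^ 2 + 1) := by
  obtain ⟨C₁, hC₁, h1⟩ := exists_lintegral_mul_inv_enorm_sub_sq_le
  obtain ⟨C₂, hC₂, h2⟩ := exists_hasL2WeakGradient_raySphere_comp
  refine ⟨ENNReal.ofReal C₂ ^ 2 * C₁, ENNReal.mul_ne_top (by finiteness) hC₁,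
    fun {n Ω A w g} hΩ hvol hA hw hw1 => ?_⟩
  have hμ : volume.restrict (Ω ∩ A) ≤ volume.restrict Ω :=
    Measure.restrict_mono_set _ inter_subset_left
  set G : Rn n → ℝ≥0∞ := fun x => ∑ i, ‖g i x‖ₑ ^ 2 + 1 with hG
  have hGm : AEMeasurable G (volume.restrict (Ω ∩ A)) :=
    (Finset.aemeasurable_fun_sum _ fun i _ =>
      ((hw.2.1 i).1.mono_measure hμ).enorm.pow_const 2).add_const 1
  have hwm : AEMeasurable w (volume.restrict (Ω ∩ A)) := (hw.1.1.mono_measure hμ).aemeasurable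
  have hgfin i : ∫⁻ x in Ω, ‖g i x‖ₑ ^ 2 ≠ ⊤ := by
    rw [← eLpNorm_two_sq]
    exact ENNReal.pow_ne_top (hw.2.1 i).2.ne
  have hGfin : ∫⁻ x in Ω ∩ A, G x ≠ ⊤ := by
    rw [hG, lintegral_add_right _ measurable_const, lintegral_finsetSum' _
      fun i _ => ((hw.2.1 i).1.mono_measure hμ).enorm.pow_const 2]
    refine ENNReal.add_ne_top.2 ⟨ENNReal.sum_ne_top.2 fun i _ =>
      ne_top_of_le_ne_top (hgfin i) (lintegral_mono' hμ le_rfl), ?_⟩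
    simpa using ne_top_of_le_ne_top hvol (measure_mono inter_subset_left)
  obtain ⟨a, ha, hle⟩ := h1 (volume.restrict (Ω ∩ A)) hwm hGm
  have hfin : ∫⁻ x in Ω ∩ A, G x * (‖w x - a‖ₑ ^ 2)⁻¹ ≠ ⊤ :=
    ne_top_of_le_ne_top (ENNReal.mul_ne_top hC₁ hGfin) hle
  -- since `G ≥ 1`, finiteness of the integral keeps `w` away from `a`
  have hneA : ∀ᵐ x ∂volume.restrict (Ω ∩ A), w x ≠ a := by
    have hmeas : AEMeasurable (fun x => G x * (‖w x - a‖ₑ ^ 2)⁻¹) (volume.restrict (Ω ∩ A)) :=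
      hGm.mul ((hwm.sub_const a).enorm.pow_const 2).inv
    filter_upwards [ae_lt_top' hmeas hfin] with x hx hxa
    rw [hxa, sub_self, enorm_zero, zero_pow two_ne_zero, ENNReal.inv_zero,
      ENNReal.mul_top (by simp [hG])] at hx
    exact lt_irrefl _ hx
  have hne : ∀ᵐ x ∂volume.restrict Ω, w x ≠ a := by
    have hneA' := hneA
    rw [ae_restrict_iff' (hΩ.measurableSet.inter hA)] at hneA'
    have hw1' := hw1
    rw [ae_restrict_iff' hΩ.measurableSet] at hw1' ⊢
    filter_upwards [hneA', hw1'] with x hx1 hx2 hxΩ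
    by_cases hxA : x ∈ A
    · exact hx1 ⟨hxΩ, hxA⟩
    · intro hxa
      have := hx2 hxΩ hxA
      rw [hxa] at this
      linarith
  have hsq (x : Rn n) (i : Fin n) (hx : w x ≠ a) :
      ‖‖w x - a‖⁻¹ * ‖g i x‖‖ₑ ^ 2 = ‖g i x‖ₑ ^ 2 * (‖w x - a‖ₑ ^ 2)⁻¹ := by
    rw [enorm_mul, enorm_inv (norm_ne_zero_iff.2 (sub_ne_zero.2 hx)), enorm_norm, enorm_norm,
      mul_pow, ENNReal.inv_pow, mul_comm]
  have hint i : MemLp (fun x => ‖w x - a‖⁻¹ * ‖g i x‖) 2 (volume.restrict Ω) := by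
    refine ⟨((hw.1.1.sub aestronglyMeasurable_const).norm.aemeasurable.inv.mul
      (hw.2.1 i).1.norm.aemeasurable).aestronglyMeasurable, ?_⟩
    rw [← ENNReal.pow_lt_top_iff.trans (or_iff_left two_ne_zero), eLpNorm_two_sq,
      ← lintegral_inter_add_sdiff _ Ω hA]
    refine ENNReal.add_lt_top.2 ⟨?_, ?_⟩
    · refine lt_of_le_of_lt (lintegral_mono_ae ?_) hfin.lt_top
      filter_upwards [hneA] with x hx
      rw [hsq x i hx]
      gcongr
      exact (Finset.single_le_sum (f := fun i => ‖g i x‖ₑ ^ 2) (fun _ _ => zero_le)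
        (Finset.mem_univ i)).trans le_self_add
    · have h3 : ∫⁻ x in Ω, 4 * ‖g i x‖ₑ ^ 2 < ⊤ := by
        rw [lintegral_const_mul' _ _ (by norm_num)]
        exact ENNReal.mul_lt_top (by norm_num) (hgfin i).lt_top
      refine lt_of_le_of_lt ?_ h3
      refine (lintegral_mono_ae ?_).trans
        (lintegral_mono' (Measure.restrict_mono_set _ sdiff_subset) le_rfl)
      have hd : MeasurableSet (Ω \ A) := hΩ.measurableSet.diff hA
      rw [ae_restrict_iff' hΩ.measurableSet] at hw1 hne
      rw [ae_restrict_iff' hd]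
      filter_upwards [hw1, hne] with x hx1 hx2 hxd
      rw [hsq x i (hx2 hxd.1), mul_comm]
      gcongr
      have h4 : 1 / 2 ≤ ‖w x - a‖ := by
        have h5 := norm_sub_norm_le (w x) a
        rw [hx1 hxd.1 hxd.2] at h5
        linarith
      rw [ENNReal.inv_le_iff_inv_le, ← ofReal_norm]
      calc (4 : ℝ≥0∞)⁻¹ = ENNReal.ofReal (1 / 2) ^ 2 := by
            rw [← ENNReal.ofReal_pow (by norm_num), ← ENNReal.ofReal_ofNat 4,
              ← ENNReal.ofReal_inv_of_pos (by norm_num)]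
            norm_num
        _ ≤ _ := by gcongr
  obtain ⟨h, hh, hhle⟩ := h2 hΩ hvol hw ha hne hint
  refine ⟨a, ha, hne, h, hh, ?_⟩
  calc ∫⁻ x in Ω ∩ A, ∑ i, ‖h i x‖ₑ ^ 2
      ≤ ∫⁻ x in Ω ∩ A, ENNReal.ofReal C₂ ^ 2 * (G x * (‖w x - a‖ₑ ^ 2)⁻¹) := by
        refine lintegral_mono_ae ?_
        filter_upwards [hneA, ae_mono hμ (ae_all_iff.2 hhle)] with x hx1 hx2
        calc ∑ i, ‖h i x‖ₑ ^ 2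
            ≤ ∑ i, ENNReal.ofReal C₂ ^ 2 * (‖g i x‖ₑ ^ 2 * (‖w x - a‖ₑ ^ 2)⁻¹) := by
              refine Finset.sum_le_sum fun i _ => ?_
              rw [← hsq x i hx1, ← mul_pow]
              refine pow_le_pow_left' ?_ 2
              rw [← ofReal_norm, ← ofReal_norm (E := ℝ), ← ENNReal.ofReal_mul hC₂]
              refine ENNReal.ofReal_le_ofReal ((hx2 i).trans ?_)
              gcongr
              exact le_abs_self _
          _ = ENNReal.ofReal C₂ ^ 2 * ((∑ i, ‖g i x‖ₑ ^ 2) * (‖w x - a‖ₑ ^ 2)⁻¹) := by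
              rw [Finset.sum_mul, Finset.mul_sum]
          _ ≤ _ := by
              gcongr
              exact le_self_add
    _ = ENNReal.ofReal C₂ ^ 2 * ∫⁻ x in Ω ∩ A, G x * (‖w x - a‖ₑ ^ 2)⁻¹ :=
        lintegral_const_mul' _ _ (by finiteness)
    _ ≤ ENNReal.ofReal C₂ ^ 2 * (C₁ * ∫⁻ x in Ω ∩ A, G x) := by gcongr
    _ = _ := by rw [mul_assoc]

end Comparison

/-! ### Interpolation between two sphere-valued maps -/

section Competitor

open Filter Topology

variable {n : ℕ}

theorem ENNReal.add_add_sq_le (x y z : ℝ≥0∞) : (x + y + z) ^ 2 ≤ 9 * (x ^ 2 + y ^ 2 + z ^ 2) := by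
  calc (x + y + z) ^ 2 ≤ (max (max x y) z + max (max x y) z + max (max x y) z) ^ 2 := by
        gcongr <;> simp
    _ = 9 * max (max x y) z ^ 2 := by ring
    _ ≤ 9 * (x ^ 2 + y ^ 2 + z ^ 2) := by
        gcongr
        rcases max_choice (max x y) z with h | h <;> rw [h]
        · rcases max_choice x y with h | h <;> rw [h]
          · exact le_self_add.trans le_self_add
          · exact le_add_self.trans le_self_add
        · exact le_add_self

/-- Interpolation between `u` near the origin and `v` far from it, with values in the sphere and
with energy controlled by the energies of `u` and `v` near the origin and by the gradient of the
cutoff. -/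
theorem exists_interpolation : ∃ C : ℝ≥0∞, C ≠ ⊤ ∧ ∃ B : ℝ, 0 ≤ B ∧
    ∀ {Ω : Set (Rn n)} {u v : Rn n → Rn 3} {gu gv : Fin n → Rn n → Rn 3} {δ : ℝ},
      IsOpen Ω → volume Ω ≠ ⊤ → HasL2WeakGradient Ω u gu → HasL2WeakGradient Ω v gv →
      (∀ᵐ x ∂volume.restrict Ω, ‖u x‖ = 1) → (∀ᵐ x ∂volume.restrict Ω, ‖v x‖ = 1) →
      MemW012 Ω (v - u) → 0 < δ →
      ∃ (w : Rn n → Rn 3) (h : Fin n → Rn n → Rn 3), HasL2WeakGradient Ω w h ∧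
        (∀ᵐ x ∂volume.restrict Ω, ‖w x‖ = 1) ∧ MemW012 Ω (w - u) ∧
        (∀ᵐ x ∂volume.restrict Ω, ‖x‖ ≤ δ → w x = u x) ∧
        ∫⁻ x in Ω, ∑ i, ‖h i x‖ₑ ^ 2 ≤ (∫⁻ x in Ω, ∑ i, ‖gv i x‖ₑ ^ 2) +
          C * ∫⁻ x in Ω ∩ Metric.closedBall 0 (2 * δ),
            (∑ i, (2 * ‖gu i x‖ₑ + ‖gv i x‖ₑ + ENNReal.ofReal (2 * B / δ)) ^ 2 + 1) := by
  obtain ⟨C, hC, hproj⟩ := exists_raySphere_comp_energy_le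
  obtain ⟨B, hB, hcut⟩ := exists_contDiff_cutoff n
  obtain ⟨L, hL, hlip⟩ := exists_norm_raySphere_sub_le
  refine ⟨C, hC, B, hB, fun {Ω u v gu gv δ} hΩ hvol hu hv hu1 hv1 htr hδ => ?_⟩
  obtain ⟨η, hηc, hη0, hη1, hηnn, hηle, hη'⟩ := hcut 0 δ hδ
  simp only [sub_zero] at hη0 hη1
  set A : Set (Rn n) := Metric.closedBall 0 (2 * δ) with hA
  have hAm : MeasurableSet A := Metric.isClosed_closedBall.measurableSet
  have hηn x : ‖η x‖ ≤ 1 := by rw [Real.norm_of_nonneg (hηnn x)]; exact hηle x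
  set q : Rn n → Rn 3 := u + fun x => η x • (v - u) x with hq
  have hqg := hu.add ((hv.sub hu).smul hηc hΩ hηn hη')
  have hfar x (hx : x ∉ A) : q x = v x := by
    have : η x = 1 := hη1 x (by simpa [hA] using (lt_of_not_ge (by simpa [hA] using hx)).le)
    simp [hq, this]
  have hnear x (hx : ‖x‖ ≤ δ) : q x = u x := by simp [hq, hη0 x hx]
  obtain ⟨a, ha, hne, h, hh, hE⟩ := hproj hΩ hvol hAm hqg (by
    filter_upwards [hv1] with x hx hxA
    exact (congrArg norm (hfar x hxA)).trans hx)
  have ha1 : ‖a‖ < 1 := by linarith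
  refine ⟨fun x => raySphere a (q x), h, hh, ?_, ?_, ?_, ?_⟩
  · filter_upwards [hne] with x hx
    exact norm_raySphere ha1 hx
  · refine MemW012.of_norm_le hΩ (hh.sub hu) htr hL ?_
    filter_upwards [hne, hu1] with x hx hux
    refine (hlip a ha (u x) (q x) hux hx).trans ?_
    gcongr
    have : q x - u x = η x • (v - u) x := by simp [hq]
    rw [this, norm_smul]
    exact mul_le_of_le_one_left (norm_nonneg _) (hηn x)
  · filter_upwards [hu1] with x hux hx
    rw [hnear x hx, raySphere_of_norm_eq_one ha1 hux]
  · have hΩA : IsOpen (Ω \ A) := hΩ.sdiff Metric.isClosed_closedBall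
    rw [← lintegral_inter_add_sdiff _ Ω hAm, add_comm]
    refine add_le_add ?_ (hE.trans ?_)
    · have hsub : volume.restrict (Ω \ A) ≤ volume.restrict Ω :=
        Measure.restrict_mono_set _ sdiff_subset
      -- off `A` the map is `v`, so its gradient there is that of `v`
      have hvA : HasWeakGradient (Ω \ A) v h := by
        refine (hh.2.2.mono sdiff_subset).congr ?_ fun i => .rfl
        filter_upwards [ae_mono hsub hv1, ae_restrict_mem hΩA.measurableSet] with x hx hxA
        exact (congrArg (raySphere a) (hfar x hxA.2)).trans (raySphere_of_norm_eq_one ha1 hx)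
      calc ∫⁻ x in Ω \ A, ∑ i, ‖h i x‖ₑ ^ 2 = ∫⁻ x in Ω \ A, ∑ i, ‖gv i x‖ₑ ^ 2 := by
            rw [← dirichletEnergy_eq hΩA hvA,
              dirichletEnergy_eq hΩA (hv.2.2.mono sdiff_subset)]
        _ ≤ _ := lintegral_mono' hsub le_rfl
    · refine mul_le_mul' le_rfl (lintegral_mono_ae ?_)
      have hsub : volume.restrict (Ω ∩ A) ≤ volume.restrict Ω :=
        Measure.restrict_mono_set _ inter_subset_left
      filter_upwards [ae_mono hsub hu1, ae_mono hsub hv1] with x hux hvx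
      refine add_le_add (Finset.sum_le_sum fun i _ => pow_le_pow_left' ?_ 2) le_rfl
      have key : ‖(gu i + fun x => partialDeriv i η x • (v - u) x +
          η x • (gv i - gu i) x) x‖ ≤ 2 * ‖gu i x‖ + ‖gv i x‖ + 2 * B / δ := by
        have h1 : ‖partialDeriv i η x • (v - u) x‖ ≤ B / δ * 2 := by
          rw [norm_smul]
          refine mul_le_mul ((norm_partialDeriv_le η i x).trans (hη' x)) ?_ (norm_nonneg _)
            (by positivity)
          have := norm_sub_le (v x) (u x)
          rw [hux, hvx] at this
          simpa using this.trans (by norm_num)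
        have h2 : ‖η x • (gv i - gu i) x‖ ≤ ‖gv i x‖ + ‖gu i x‖ := by
          rw [norm_smul]
          exact (mul_le_of_le_one_left (norm_nonneg _) (hηn x)).trans (norm_sub_le _ _)
        have h3 := norm_add_le (gu i x)
          (partialDeriv i η x • (v - u) x + η x • (gv i - gu i) x)
        have h4 := norm_add_le (partialDeriv i η x • (v - u) x) (η x • (gv i - gu i) x)
        have h5 : 2 * B / δ = B / δ * 2 := by ring
        simp only [Pi.add_apply] at h3 ⊢
        linarith
      have key' := ENNReal.ofReal_le_ofReal key
      rw [ofReal_norm, ENNReal.ofReal_add (by positivity) (by positivity),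
        ENNReal.ofReal_add (by positivity) (by positivity), ENNReal.ofReal_mul (by norm_num),
        ofReal_norm, ofReal_norm] at key'
      simpa using key'

/-- In dimension `n ≥ 3` the error terms of the interpolation vanish as the ball shrinks: the
cutoff contributes `δ⁻²` times a volume of order `δ^n`. -/
theorem tendsto_interpolation_error (hn : 3 ≤ n) {Ω : Set (Rn n)}
    {gu gv : Fin n → Rn n → Rn 3} (hgu : ∀ i, MemLp (gu i) 2 (volume.restrict Ω))
    (hgv : ∀ i, MemLp (gv i) 2 (volume.restrict Ω)) (hΩ : MeasurableSet Ω) {B : ℝ} (hB : 0 ≤ B)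
    {δ : ℕ → ℝ} (hδ0 : ∀ k, 0 < δ k) (hδ : Tendsto δ atTop (𝓝 0)) :
    Tendsto (fun k => ∫⁻ x in Ω ∩ Metric.closedBall 0 (2 * δ k),
      (∑ i, (2 * ‖gu i x‖ₑ + ‖gv i x‖ₑ + ENNReal.ofReal (2 * B / δ k)) ^ 2 + 1)) atTop (𝓝 0) := by
  have : Nonempty (Fin n) := ⟨⟨0, by omega⟩⟩
  set A : ℕ → Set (Rn n) := fun k => Metric.closedBall 0 (2 * δ k) with hA
  have hAm k : MeasurableSet (A k) := Metric.isClosed_closedBall.measurableSet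
  have hvolA k : volume (A k) =
      ENNReal.ofReal ((2 * δ k) ^ n) * volume (Metric.ball (0 : Rn n) 1) := by
    rw [hA, Measure.addHaar_closedBall _ _ (by have := hδ0 k; positivity)]
    simp
  set V : ℝ≥0∞ := volume (Metric.ball (0 : Rn n) 1)
  have hV : V ≠ ⊤ := measure_ball_lt_top.ne
  have hvol : Tendsto (fun k => volume (A k)) atTop (𝓝 0) := by
    have h1 : Tendsto (fun k => (2 * δ k) ^ n) atTop (𝓝 0) := by
      have := (hδ.const_mul 2).pow n
      rwa [mul_zero, zero_pow (by omega)] at this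
    have h2 := ENNReal.Tendsto.mul_const (b := V) (ENNReal.tendsto_ofReal h1) (.inr hV)
    simp only [hvolA]
    simpa using h2
  have hvol' : Tendsto (fun k => ENNReal.ofReal (2 * B / δ k) ^ 2 * volume (A k)) atTop (𝓝 0) := by
    have h1 : Tendsto (fun k => 4 * B ^ 2 * 2 ^ n * δ k ^ (n - 2)) atTop (𝓝 0) := by
      have := (hδ.pow (n - 2)).const_mul (4 * B ^ 2 * 2 ^ n)
      rwa [zero_pow (by omega), mul_zero] at this
    have h2 := ENNReal.Tendsto.mul_const (b := V) (ENNReal.tendsto_ofReal h1) (.inr hV)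
    rw [ENNReal.ofReal_zero, zero_mul] at h2
    refine h2.congr fun k => ?_
    have hk := hδ0 k
    rw [hvolA, ← mul_assoc, ← ENNReal.ofReal_pow (by positivity),
      ← ENNReal.ofReal_mul (by positivity)]
    congr 2
    obtain ⟨m, rfl⟩ : ∃ m, n = m + 2 := ⟨n - 2, by omega⟩
    rw [Nat.add_sub_cancel]
    field_simp
    ring
  have hg {g : Rn n → Rn 3} (hg : MemLp g 2 (volume.restrict Ω)) :
      Tendsto (fun k => ∫⁻ x in Ω ∩ A k, ‖g x‖ₑ ^ 2) atTop (𝓝 0) := by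
    have hfin : ∫⁻ x in Ω, ‖g x‖ₑ ^ 2 ≠ ⊤ := by
      rw [← eLpNorm_two_sq]
      exact ENNReal.pow_ne_top hg.2.ne
    have h1 := tendsto_setLIntegral_zero (μ := volume.restrict Ω) hfin (s := A) (l := atTop)
      (tendsto_of_tendsto_of_tendsto_of_le_of_le tendsto_const_nhds hvol (fun _ => zero_le)
        fun k => Measure.restrict_apply_le _ _)
    refine h1.congr fun k => ?_
    rw [Measure.restrict_restrict (hAm k), inter_comm]
  have hbd : Tendsto (fun k => ∑ i, 9 * (4 * ∫⁻ x in Ω ∩ A k, ‖gu i x‖ₑ ^ 2) +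
      ∑ i, 9 * (∫⁻ x in Ω ∩ A k, ‖gv i x‖ₑ ^ 2) +
      ∑ _i : Fin n, 9 * (ENNReal.ofReal (2 * B / δ k) ^ 2 * volume (A k)) + volume (A k))
      atTop (𝓝 0) := by
    have hmul {f : ℕ → ℝ≥0∞} (hf : Tendsto f atTop (𝓝 0)) (c : ℝ≥0∞) (hc : c ≠ ⊤) :
        Tendsto (fun k => c * f k) atTop (𝓝 0) := by
      simpa using ENNReal.Tendsto.const_mul hf (.inr hc)
    have h1 := tendsto_finsetSum Finset.univ fun i (_ : i ∈ Finset.univ) =>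
      hmul (hmul (hg (hgu i)) 4 (by norm_num)) 9 (by norm_num)
    have h2 := tendsto_finsetSum Finset.univ fun i (_ : i ∈ Finset.univ) =>
      hmul (hg (hgv i)) 9 (by norm_num)
    have h3 := tendsto_finsetSum Finset.univ fun (i : Fin n) (_ : i ∈ Finset.univ) =>
      hmul hvol' 9 (by norm_num)
    simpa using ((h1.add h2).add h3).add hvol
  refine tendsto_of_tendsto_of_tendsto_of_le_of_le tendsto_const_nhds hbd (fun _ => zero_le)
    fun k => ?_
  have hμ : volume.restrict (Ω ∩ A k) ≤ volume.restrict Ω :=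
    Measure.restrict_mono_set _ inter_subset_left
  have hm {g : Rn n → Rn 3} (hg : MemLp g 2 (volume.restrict Ω)) :
      AEMeasurable (fun x => ‖g x‖ₑ ^ 2) (volume.restrict (Ω ∩ A k)) :=
    (hg.1.mono_measure hμ).enorm.pow_const 2
  set c := ENNReal.ofReal (2 * B / δ k)
  have hvk : volume (Ω ∩ A k) ≤ volume (A k) := measure_mono inter_subset_right
  calc ∫⁻ x in Ω ∩ A k, (∑ i, (2 * ‖gu i x‖ₑ + ‖gv i x‖ₑ + c) ^ 2 + 1)
      ≤ ∫⁻ x in Ω ∩ A k, (∑ i, 9 * (4 * ‖gu i x‖ₑ ^ 2 + ‖gv i x‖ₑ ^ 2 + c ^ 2) + 1) := by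
        gcongr with x i
        refine (ENNReal.add_add_sq_le _ _ _).trans_eq ?_
        rw [mul_pow]
        norm_num
    _ = ∑ i, 9 * (4 * (∫⁻ x in Ω ∩ A k, ‖gu i x‖ₑ ^ 2) +
          (∫⁻ x in Ω ∩ A k, ‖gv i x‖ₑ ^ 2) + c ^ 2 * volume (Ω ∩ A k)) +
          volume (Ω ∩ A k) := by
        have hs i : AEMeasurable (fun x => 9 * (4 * ‖gu i x‖ₑ ^ 2 + ‖gv i x‖ₑ ^ 2 + c ^ 2))
            (volume.restrict (Ω ∩ A k)) :=
          ((((hm (hgu i)).const_mul 4).add (hm (hgv i))).add_const _).const_mul 9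
        rw [lintegral_add_right _ measurable_const, lintegral_finsetSum' _ fun i _ => hs i]
        congr 1
        · refine Finset.sum_congr rfl fun i _ => ?_
          rw [lintegral_const_mul' _ _ (by norm_num), lintegral_add_right _ measurable_const,
            lintegral_add_right' _ (hm (hgv i)), lintegral_const_mul' _ _ (by norm_num)]
          simp
        · simp
    _ ≤ _ := by
        simp only [mul_add, Finset.sum_add_distrib]
        gcongr

end Competitor

/-! ### Exhaustion by half-annuli -/

section Exhaustion

open Filter Topology

variable {n : ℕ}

open Classical in
/-- A map that has a weak gradient on each member of an increasing sequence of open sets, with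
uniformly bounded energies, has a square-integrable weak gradient on the union. -/
theorem exists_hasL2WeakGradient_iUnion {U : ℕ → Set (Rn n)} (hUo : ∀ k, IsOpen (U k))
    (hU : Monotone U) {u : Rn n → Rn 3} (hu : MemLp u 2 (volume.restrict (⋃ k, U k)))
    {g : ℕ → Fin n → Rn n → Rn 3} (hg : ∀ k, HasL2WeakGradient (U k) u (g k)) {Λ : ℝ≥0∞}
    (hΛ : Λ ≠ ⊤) (hb : ∀ k, ∫⁻ x in U k, ∑ i, ‖g k i x‖ₑ ^ 2 ≤ Λ) :
    ∃ G, HasL2WeakGradient (⋃ k, U k) u G := by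
  -- At each point the gradient of the first member containing that point is used.
  let G : Fin n → Rn n → Rn 3 := fun i x =>
    if h : ∃ k, x ∈ U k then g (Nat.find h) i x else 0
  have hG k i : G i =ᵐ[volume.restrict (U k)] g k i := by
    have hjk : ∀ j, ∀ᵐ x ∂volume.restrict (U k), x ∈ U j → j ≤ k → g j i x = g k i x := by
      intro j
      by_cases hj : j ≤ k
      · have := (hg j).2.2.ae_eq (hUo j) ((hg k).2.2.mono (hU hj)) i
        rw [Filter.EventuallyEq, ae_restrict_iff' (hUo j).measurableSet] at this
        filter_upwards [ae_restrict_of_ae this] with x hx hxj _ using hx hxj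
      · exact .of_forall fun x _ h => absurd h hj
    filter_upwards [ae_all_iff.2 hjk, ae_restrict_mem (hUo k).measurableSet] with x hx hxk
    have h : ∃ k, x ∈ U k := ⟨k, hxk⟩
    simp only [G, dif_pos h]
    exact hx _ (Nat.find_spec h) (Nat.find_min' h hxk)
  have hGL i : MemLp (G i) 2 (volume.restrict (⋃ k, U k)) := by
    refine ⟨aestronglyMeasurable_iUnion_iff.2 fun k => ((hg k).2.1 i).1.congr (hG k i).symm, ?_⟩
    have hfin : eLpNorm (G i) 2 (volume.restrict (⋃ k, U k)) ^ 2 ≤ Λ := by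
      rw [eLpNorm_two_sq, setLIntegral_iUnion_of_directed _ hU.directed_le]
      refine iSup_le fun k => le_trans ?_ (hb k)
      refine lintegral_mono_ae ?_
      filter_upwards [hG k i] with x hx
      rw [hx]
      exact Finset.single_le_sum (f := fun i => ‖g k i x‖ₑ ^ 2) (fun _ _ => zero_le)
        (Finset.mem_univ i)
    by_contra h
    rw [not_lt_top_iff.1 h] at hfin
    exact hΛ (top_le_iff.1 (by simpa using hfin))
  refine ⟨G, hu, hGL, hasWeakGradient_iff.2 ⟨hu.locallyIntegrableOn_of_restrict,
    fun i => (hGL i).locallyIntegrableOn_of_restrict, fun φ hφ i => ?_⟩⟩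
  obtain ⟨k, hk⟩ := hφ.2.1.isCompact.elim_directed_cover U hUo hφ.2.2 hU.directed_le
  exact ((hg k).2.2.congr .rfl fun i => (hG k i).symm).integral_eq ⟨hφ.1, hφ.2.1, hk⟩ i

/-- Maps that agree almost everywhere have the same trace. -/
theorem SameTrace.of_ae_eq {Ω : Set (Rn n)} {u v : Rn n → Rn 3}
    (h : u =ᵐ[volume.restrict Ω] v) : SameTrace Ω u v := by
  have h0 : u - v =ᵐ[volume.restrict Ω] 0 := h.mono fun x hx => by simp [hx]
  have hz : HasL2WeakGradient Ω (0 : Rn n → Rn 3) (fun _ => 0) :=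
    ⟨MemLp.zero, fun _ => MemLp.zero, hasWeakGradient_iff.2
      ⟨locallyIntegrableOn_zero, fun _ => locallyIntegrableOn_zero, fun φ _ i => by simp⟩⟩
  refine ⟨fun _ => 0, ⟨hz.1.ae_eq h0.symm, hz.2.1, hz.2.2.congr h0.symm fun _ => .rfl⟩,
    fun ε hε => ⟨0, ⟨contDiff_const, .zero, by simp⟩, ?_, fun i => ?_⟩⟩
  · rwa [sub_zero, eLpNorm_congr_ae h0, eLpNorm_zero]
  · have : partialDeriv i (0 : Rn n → Rn 3) = 0 := by
      funext x
      simp [partialDeriv]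
    rwa [this, sub_zero, eLpNorm_zero]

theorem iUnion_halfAnnulus (hn : n ≠ 0) {δ : ℕ → ℝ} (hδ : Tendsto δ atTop (𝓝 0)) :
    ⋃ k, halfAnnulus n (δ k) = halfBall n 1 := by
  refine subset_antisymm (iUnion_subset fun k => sdiff_subset) fun x hx => ?_
  -- the last coordinate of `x` is positive
  have hx0 : 0 < ‖x‖ := by
    refine norm_pos_iff.2 fun h => ?_
    have := hx.2 ⟨n - 1, by omega⟩ (by simp; omega)
    simp [h] at this
  obtain ⟨k, hk⟩ := (hδ.eventually (gt_mem_nhds hx0)).exists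
  exact mem_iUnion.2 ⟨k, hx, by simpa using hk⟩

end Exhaustion

theorem mainTheorem11 (n : ℕ) (hn : 3 ≤ n) (u : Rn n → Rn 3)
    (hu : ∀ δ : ℝ, 0 < δ → MemW12Sphere (halfAnnulus n δ) u)
    (hbound : ∃ Λ : ℝ≥0∞, Λ < ⊤ ∧
      ∀ δ ∈ Ioo (0 : ℝ) 1, dirichletEnergy (halfAnnulus n δ) u ≤ Λ)
    (hmin : ∀ δ : ℝ, 0 < δ → δ < 1 → ∀ v : Rn n → Rn 3, MemW12Sphere (halfBall n 1) v →
      SameTrace (halfBall n 1) v u → SameTrace (halfBall n δ) v u →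
      dirichletEnergy (halfAnnulus n δ) u ≤ dirichletEnergy (halfAnnulus n δ) v) :
    MemW12 (halfBall n 1) u ∧ IsMinimizingHarmonicMap (halfBall n 1) u := by
  obtain ⟨Λ, hΛ, hbound⟩ := hbound
  set Ω := halfBall n 1 with hΩdef
  have hΩ : IsOpen Ω := isOpen_halfBall 1
  have hvol : volume Ω ≠ ⊤ :=
    ((measure_mono inter_subset_left).trans_lt Metric.isBounded_ball.measure_lt_top).ne
  let δ : ℕ → ℝ := fun k => 1 / ((k : ℝ) + 2)
  have hδ0 k : 0 < δ k := by positivity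
  have hδ1 k : δ k < 1 := by
    rw [div_lt_one (by positivity)]
    linarith [(Nat.cast_nonneg k : (0 : ℝ) ≤ k)]
  have hδanti : Antitone δ := fun j k hjk => by
    have : (j : ℝ) ≤ k := by exact_mod_cast hjk
    exact one_div_le_one_div_of_le (by positivity) (by linarith)
  have hδ : Filter.Tendsto δ Filter.atTop (nhds 0) :=
    tendsto_const_nhds.div_atTop
      (Filter.tendsto_atTop_add_const_right _ _ tendsto_natCast_atTop_atTop)
  let U : ℕ → Set (Rn n) := fun k => halfAnnulus n (δ k)
  have hUo k : IsOpen (U k) := isOpen_halfAnnulus _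
  have hUm : Monotone U := fun j k hjk =>
    sdiff_subset_sdiff_right (Metric.closedBall_subset_closedBall (hδanti hjk))
  have hUΩ : ⋃ k, U k = Ω := iUnion_halfAnnulus (by omega) hδ
  have hUsub k : U k ⊆ Ω := sdiff_subset
  have hu1 : ∀ᵐ x ∂volume.restrict Ω, ‖u x‖ = 1 := by
    rw [← hUΩ, ae_restrict_iUnion_iff]
    exact fun k => (hu (δ k) (hδ0 k)).2.mono fun x hx => mem_sphere_zero_iff_norm.1 hx
  choose g hg using fun k => (hu (δ k) (hδ0 k)).1
  have huL : MemLp u 2 (volume.restrict (⋃ k, U k)) := by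
    have : IsFiniteMeasure (volume.restrict (⋃ k, U k)) :=
      isFiniteMeasure_restrict.2 (hUΩ ▸ hvol)
    refine MemLp.of_bound (aestronglyMeasurable_iUnion_iff.2 fun k => (hg k).1.1) 1 ?_
    rw [hUΩ]
    exact hu1.mono fun x hx => hx.le
  obtain ⟨G, hG⟩ := exists_hasL2WeakGradient_iUnion hUo hUm huL hg hΛ.ne fun k => by
    rw [← dirichletEnergy_eq (hUo k) (hg k).2.2]
    exact hbound (δ k) ⟨hδ0 k, hδ1 k⟩
  rw [hUΩ] at hG
  refine ⟨⟨G, hG⟩, ⟨⟨G, hG⟩, hu1.mono fun x hx => mem_sphere_zero_iff_norm.2 hx⟩,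
    fun v ⟨⟨gv, hv⟩, hv1⟩ htr => ?_⟩
  obtain ⟨C, hC, B, hB, hinter⟩ := exists_interpolation (n := n)
  have herr := tendsto_interpolation_error hn hG.2.1 hv.2.1 hΩ.measurableSet hB hδ0 hδ
  set err : ℕ → ℝ≥0∞ := fun k => ∫⁻ x in Ω ∩ Metric.closedBall 0 (2 * δ k),
    (∑ i, (2 * ‖G i x‖ₑ + ‖gv i x‖ₑ + ENNReal.ofReal (2 * B / δ k)) ^ 2 + 1)
  -- the interpolation between `u` on `B_δ` and `v` off `B_{2δ}` is admissible in `hmin`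
  have hle k : ∫⁻ x in U k, ∑ i, ‖G i x‖ₑ ^ 2 ≤
      (∫⁻ x in Ω, ∑ i, ‖gv i x‖ₑ ^ 2) + C * err k := by
    obtain ⟨w, h, hw, hw1, hwtr, hwu, hwE⟩ := hinter hΩ hvol hG hv hu1
      (hv1.mono fun x hx => mem_sphere_zero_iff_norm.1 hx) htr (hδ0 k)
    have hsub : halfBall n (δ k) ⊆ Ω :=
      inter_subset_inter_left _ (Metric.ball_subset_ball (hδ1 k).le)
    have hwu' : w =ᵐ[volume.restrict (halfBall n (δ k))] u := by
      filter_upwards [ae_mono (Measure.restrict_mono_set _ hsub) hwu,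
        ae_restrict_mem (isOpen_halfBall _).measurableSet] with x hx hxδ
      exact hx (by simpa using (mem_ball_zero_iff.1 hxδ.1).le)
    have := hmin (δ k) (hδ0 k) (hδ1 k) w
      ⟨⟨h, hw⟩, hw1.mono fun x hx => mem_sphere_zero_iff_norm.2 hx⟩ hwtr (.of_ae_eq hwu')
    rw [dirichletEnergy_eq (hUo k) (hG.2.2.mono (hUsub k)),
      dirichletEnergy_eq (hUo k) (hw.2.2.mono (hUsub k))] at this
    exact this.trans ((lintegral_mono_set (hUsub k)).trans hwE)
  rw [dirichletEnergy_eq hΩ hG.2.2, dirichletEnergy_eq hΩ hv.2.2, ← hUΩ,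
    setLIntegral_iUnion_of_directed _ hUm.directed_le, hUΩ]
  -- on a fixed half-annulus the bounds for all smaller radii apply
  refine iSup_le fun k => ?_
  have hlim : Filter.Tendsto (fun j => (∫⁻ x in Ω, ∑ i, ‖gv i x‖ₑ ^ 2) + C * err j) Filter.atTop
      (nhds (∫⁻ x in Ω, ∑ i, ‖gv i x‖ₑ ^ 2)) := by
    simpa using (ENNReal.Tendsto.const_mul herr (.inr hC)).const_add
      (∫⁻ x in Ω, ∑ i, ‖gv i x‖ₑ ^ 2)
  refine ge_of_tendsto hlim ?_
  filter_upwards [Filter.eventually_ge_atTop k] with j hj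
  exact (lintegral_mono_set (hUm hj)).trans (hle j)
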